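/- **Notation.** Let $k$ be a field. All schemes and morphisms below are over $k$, and $\mathbb A^n_X = X\times\mathbb A^n$. *Framed correspondences.* An explicit framed correspondence of level $n$ from $X$ to $Y$ is a tuple $(Z,U,\varphi;g)$: a closed subset $Z\subset \mathbb A^n_X$ (the support) that, with its reduced structure, is finite over $X$; an étale neighbourhood $p:U\to\mathbb A^n_X$ of $Z$ (that is, $p$ is étale and $p^{-1}(Z)\to Z$ is an isomorphism); regular functions $\varphi=(\varphi_1,\dots,\varphi_n)$ on $U$ whose common zero set is $p^{-1}(Z)$; and a morphism $g:U\to Y$. Two of them are equivalent if they have the same support and their $\varphi$ and $g$ agree on a common étale neighbourhood of it; $Fr_n(X,Y)$ is the set of classes. The composite of $(Z,U,\varphi;g)\in Fr_m(X,Y)$ and $(Z',U',\varphi';g')\in Fr_n(Y,T)$ is $(Z\times_YZ',\,U\times_YU',\,(\varphi,\varphi');\,g')\in Fr_{m+n}(X,T)$. Let $\mathbb ZF_n(X,Y)$ be the quotient of the free abelian group on $Fr_n(X,Y)$ by the elements $a-a_1-a_2$, where the support of $a$ is the disjoint union of two closed subsets $Z_1,Z_2$ and $a_i$ is the restriction of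 $a$ to a neighbourhood of $Z_i$; composition extends biadditively. A morphism $X\to Y$ is regarded as an element of $\mathbb ZF_0(X,Y)$, and $\sigma_X=(X\times 0,\,X\times\mathbb A^1,\,t;\,pr_X)\in\mathbb ZF_1(X,X)$. *Pairs.* A pair $(X,X^0)$ is a scheme $X$ with an open subset $X^0$. Let $\mathbb ZF_n((X,X^0),(Y,Y^0))$ be the group of $(a,b)\in\mathbb ZF_n(X,Y)\oplus\mathbb ZF_n(X^0,Y^0)$ whose images in $\mathbb ZF_n(X^0,Y)$ agree; composition is componentwise. A morphism of pairs $f$ gives an element $\langle\langle f\rangle\rangle$ of level $0$, and $\langle\langle\sigma_X\rangle\rangle=(\sigma_X,\sigma_{X^0})$ has level $1$. Let $\overline{\overline{\mathbb ZF}}_n(A,B)$ be the quotient of $\mathbb ZF_n(A,B)$ by the subgroup generated by the differences $i_0^*H-i_1^*H$ with $H\in\mathbb ZF_n(\mathbb A^1\times A,B)$ and by the level-$n$ composites of elements of $\mathbb ZF_*(A,(E,E))$ and $\mathbb ZF_*((E,E),B)$, where $E$ is essentially smooth over $k$, i.e. a localization of a smooth separated $k$-scheme of finite type (equivalently, identities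 of pairs $(E,E)$ are annihilated). Write $\overline{[[c]]}$ for the class of $c$; then $\overline{[[c]]}\circ\overline{[[d]]}=\overline{[[c\circ d]]}$. **Theorem (Excision on the relative affine line).** Let $X$ be a smooth separated $k$-scheme of finite type, $x\in X$ a point and $W=\operatorname{Spec}\mathcal O_{X,x}$. Let $f\in\mathcal O_{X,x}[t]$ be a monic polynomial with $f(0)\in\mathcal O_{X,x}^\times$, let $V=(\mathbb A^1_W)_f\subset\mathbb A^1_W$ be the locus where $f$ is invertible, so that $0\times W\subset V$, and let $i:(V,V-0\times W)\to(\mathbb A^1_W,\mathbb A^1_W-0\times W)$ be the inclusion. Then there are $$r,\ l\in\mathbb ZF_1\big((\mathbb A^1_W,\mathbb A^1_W-0\times W),(V,V-0\times W)\big)$$ such that $$\overline{[[i]]}\circ\overline{[[r]]}=\overline{[[\sigma_{\mathbb A^1_W}]]}\quad\text{and}\quad\overline{[[l]]}\circ\overline{[[i]]}=\overline{[[\sigma_V]]}$$ in $\overline{\overline{\mathbb ZF}}_1\big((\mathbb A^1_W,\mathbb A^1_W-0\times W),(\mathbb A^1_W,\mathbb A^1_W-0\times W)\big)$ and in $\overline{\overline{\mathbb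 ZF}}_1\big((V,V-0\times W),(V,V-0\times W)\big)$ respectively. -/

import Mathlib

open CategoryTheory CategoryTheory.Limits AlgebraicGeometry TopologicalSpace

universe u

noncomputable section

namespace FramedCorr

/-! ### Affine space and reduced closed subschemes -/

/-- The affine space `𝔸ⁿ_X` (equivalently `X × 𝔸ⁿ`) over a scheme `X`. -/
abbrev Aff (n : ℕ) (X : Scheme.{u}) : Scheme.{u} := AffineSpace (ULift.{u} (Fin n)) X

namespace Aff

/-- The projection `𝔸ⁿ_X ⟶ X`. -/
def pr (n : ℕ) (X : Scheme.{u}) : Aff n X ⟶ X := Aff n X ↘ X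

instance (n : ℕ) (X : Scheme.{u}) : IsAffineHom (pr n X) :=
  inferInstanceAs (IsAffineHom (AffineSpace (ULift.{u} (Fin n)) X ↘ X))

instance (X : Scheme.{u}) : IsIso (pr 0 X) :=
  inferInstanceAs (IsIso (AffineSpace (ULift.{u} (Fin 0)) X ↘ X))

/-- The standard coordinate functions on `𝔸ⁿ_X`. -/
def coord {n : ℕ} (X : Scheme.{u}) (i : Fin n) : Γ(Aff n X, ⊤) := AffineSpace.coord X ⟨i⟩

/-- The morphism `T ⟶ 𝔸ⁿ_X` given by a morphism `T ⟶ X` and `n` regular functions on `T`. -/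
def lift {n : ℕ} {T X : Scheme.{u}} (f : T ⟶ X) (v : Fin n → Γ(T, ⊤)) : T ⟶ Aff n X :=
  AffineSpace.homOfVector f fun i => v i.down

@[simp]
lemma lift_pr {n : ℕ} {T X : Scheme.{u}} (f : T ⟶ X) (v : Fin n → Γ(T, ⊤)) :
    lift f v ≫ pr n X = f :=
  AffineSpace.homOfVector_over _ _

@[simp]
lemma lift_pr_assoc {n : ℕ} {T X X' : Scheme.{u}} (f : T ⟶ X) (v : Fin n → Γ(T, ⊤)) (g : X ⟶ X') :
    lift f v ≫ pr n X ≫ g = f ≫ g := by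
  rw [← Category.assoc, lift_pr]

lemma lift_coord {n : ℕ} {T X : Scheme.{u}} (f : T ⟶ X) (v : Fin n → Γ(T, ⊤)) (i : Fin n) :
    (lift f v).appTop (coord X i) = v i :=
  AffineSpace.homOfVector_appTop_coord _ _ _

lemma hom_ext {n : ℕ} {T X : Scheme.{u}} {f g : T ⟶ Aff n X}
    (h : f ≫ pr n X = g ≫ pr n X)
    (h' : ∀ i, f.appTop (coord X i) = g.appTop (coord X i)) : f = g :=
  AffineSpace.hom_ext h fun i => h' i.down

lemma comp_appTop {T T' X : Scheme.{u}} (f : T ⟶ T') (g : T' ⟶ X) (x : Γ(X, ⊤)) :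
    (f ≫ g).appTop x = f.appTop (g.appTop x) := rfl

end Aff

/-- The closed immersion into `B` of a closed subset `Z` with its reduced scheme structure. -/
abbrev redι {B : Scheme.{u}} (Z : Closeds B) :
    (Scheme.IdealSheafData.vanishingIdeal Z).subscheme ⟶ B :=
  (Scheme.IdealSheafData.vanishingIdeal Z).subschemeι

lemma range_redι {B : Scheme.{u}} (Z : Closeds B) : Set.range (redι Z) = Z := by
  rw [Scheme.IdealSheafData.range_subschemeι, Scheme.IdealSheafData.coe_support_vanishingIdeal]

lemma exists_redι_fac {T B : Scheme.{u}} (i : T ⟶ B) [IsClosedImmersion i] (Z : Closeds B)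
    (h : (Z : Set B) ⊆ Set.range i) : ∃ l, l ≫ i = redι Z ∧ IsClosedImmersion l := by
  have H : i.ker ≤ (redι Z).ker := by
    rw [Scheme.IdealSheafData.ker_subschemeι,
      ← Scheme.IdealSheafData.le_support_iff_le_vanishingIdeal]
    intro x hx
    exact i.range_subset_ker_support (h hx)
  refine ⟨IsClosedImmersion.lift i (redι Z) H, IsClosedImmersion.lift_fac _ _ _, ?_⟩
  have : IsClosedImmersion (IsClosedImmersion.lift i (redι Z) H ≫ i) := by
    rw [IsClosedImmersion.lift_fac]; infer_instance
  exact IsClosedImmersion.of_comp_isClosedImmersion _ i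

/-! ### Framed correspondences -/

/-- `p : U ⟶ B` is an étale neighbourhood of the closed subset `Z` of `B`: it is étale and
`p⁻¹(Z) ⟶ Z` is an isomorphism, where `Z` carries the reduced scheme structure. -/
structure IsEtaleNbhd {U B : Scheme.{u}} (p : U ⟶ B) (Z : Closeds B) : Prop where
  etale : Etale p
  isIso : IsIso (pullback.snd p (redι Z))

/-- The tautological section `Z ⟶ U` of an étale neighbourhood. -/
lemma IsEtaleNbhd.exists_section {U B : Scheme.{u}} {p : U ⟶ B} {Z : Closeds B}
    (h : IsEtaleNbhd p Z) : ∃ s, IsPullback s (𝟙 _) p (redι Z) := by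
  have := h.isIso
  refine ⟨inv (pullback.snd p (redι Z)) ≫ pullback.fst p (redι Z), ?_⟩
  refine IsPullback.of_iso (IsPullback.of_hasPullback p (redι Z))
    (asIso (pullback.snd p (redι Z))) (Iso.refl _) (Iso.refl _) (Iso.refl _) ?_ ?_ ?_ ?_ <;> simp

lemma isEtaleNbhd_of_isPullback {T U B : Scheme.{u}} {p : U ⟶ B} {Z : Closeds B} (hp : Etale p)
    (i : T ⟶ B) [IsClosedImmersion i] (hi : (Z : Set B) ⊆ Set.range i) (s : T ⟶ U)
    (h : IsPullback s (𝟙 _) p i) : IsEtaleNbhd p Z := by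
  refine ⟨hp, ?_⟩
  obtain ⟨l, hl, -⟩ := exists_redι_fac i Z hi
  have h2 : IsPullback l (𝟙 _) (𝟙 T) l := IsPullback.of_vert_isIso ⟨by simp⟩
  have h3 := h2.paste_horiz h
  rw [hl] at h3
  rw [← h3.isoPullback_inv_snd]
  infer_instance

lemma IsEtaleNbhd.injective {U B : Scheme.{u}} {p : U ⟶ B} {Z : Closeds B}
    (h : IsEtaleNbhd p Z) {x y : U} (hxy : p x = p y) (hx : p x ∈ Z) : x = y := by
  obtain ⟨s, hs⟩ := h.exists_section
  have key : ∀ x : U, p x ∈ Z → ∃ z, s z = x ∧ redι Z z = p x := by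
    intro x hx
    have : p x ∈ Set.range (redι Z) := by rw [range_redι]; exact hx
    obtain ⟨z, hz⟩ := this
    obtain ⟨w, hw, hw'⟩ := Scheme.exists_preimage_of_isPullback hs x z hz.symm
    refine ⟨w, hw, ?_⟩
    rw [← hz, ← hw']; simp
  obtain ⟨z, hz, hz'⟩ := key x hx
  obtain ⟨w, hw, hw'⟩ := key y (hxy ▸ hx)
  have : z = w := (redι Z).isClosedEmbedding.injective (by rw [hz', hw', hxy])
  rw [← hz, ← hw, this]

lemma IsEtaleNbhd.exists_preimage {U B : Scheme.{u}} {p : U ⟶ B} {Z : Closeds B}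
    (h : IsEtaleNbhd p Z) {z : B} (hz : z ∈ Z) : ∃ x : U, p x = z := by
  obtain ⟨s, hs⟩ := h.exists_section
  have : z ∈ Set.range (redι Z) := by rw [range_redι]; exact hz
  obtain ⟨w, rfl⟩ := this
  exact ⟨s w, by rw [← Scheme.Hom.comp_apply, hs.w]; simp⟩

/-- An explicit framed correspondence of level `n` from `X` to `Y`, for schemes over `S`. -/
structure ExplicitFr {S : Scheme.{u}} (n : ℕ) (X Y : Over S) where
  /-- the support -/
  Z : Closeds (Aff n X.left)
  finite : IsFinite (redι Z ≫ Aff.pr n X.left)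
  /-- the étale neighbourhood of the support -/
  U : Scheme.{u}
  p : U ⟶ Aff n X.left
  nbhd : IsEtaleNbhd p Z
  /-- the framing functions -/
  φ : Fin n → Γ(U, ⊤)
  zeroLocus_φ : U.zeroLocus (Set.range φ) = p ⁻¹' (Z : Set (Aff n X.left))
  /-- the morphism to the target, a morphism over `S` -/
  g : U ⟶ Y.left
  g_over : g ≫ Y.hom = p ≫ Aff.pr n X.left ≫ X.hom

namespace ExplicitFr

variable {S : Scheme.{u}}

/-- `c` is obtained from `a` by pulling back the framing functions and the morphism to the target
along a morphism of the étale neighbourhoods (the supports may differ). -/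
def Restricts {n : ℕ} {X Y : Over S} (c a : ExplicitFr n X Y) : Prop :=
  ∃ j : c.U ⟶ a.U, j ≫ a.p = c.p ∧ (∀ i, j.appTop (a.φ i) = c.φ i) ∧ j ≫ a.g = c.g

/-- Two explicit framed correspondences with the same support are equivalent if their data agree on
a common étale neighbourhood of the support. -/
def Equivalent {n : ℕ} {X Y : Over S} (a b : ExplicitFr n X Y) : Prop :=
  ∃ c : ExplicitFr n X Y, c.Z = a.Z ∧ c.Z = b.Z ∧ c.Restricts a ∧ c.Restricts b

/-- The support of `a` is the disjoint union of the supports of `a₁` and `a₂`, and `a₁`, `a₂` are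
the restrictions of `a` to neighbourhoods of these two closed subsets. -/
def IsDisjointSum {n : ℕ} {X Y : Over S} (a a₁ a₂ : ExplicitFr n X Y) : Prop :=
  a.Z = a₁.Z ⊔ a₂.Z ∧ Disjoint (a₁.Z : Set (Aff n X.left)) a₂.Z ∧ a₁.Restricts a ∧ a₂.Restricts a

end ExplicitFr
end FramedCorr

namespace FramedCorr

/-! ### Composition of framed correspondences -/

/-- Concatenation of a family of length `m` and a family of length `n`, as a family of length
`N = m + n`. -/
def append {m n N : ℕ} (h : m + n = N) {R : Type*} (v : Fin m → R) (w : Fin n → R) : Fin N → R :=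
  fun i => Fin.append v w (Fin.cast h.symm i)

lemma append_left {m n N : ℕ} (h : m + n = N) {R : Type*} (v : Fin m → R) (w : Fin n → R)
    (i : Fin m) : append h v w (Fin.cast h (Fin.castAdd n i)) = v i := by
  simp [append]

lemma append_right {m n N : ℕ} (h : m + n = N) {R : Type*} (v : Fin m → R) (w : Fin n → R)
    (i : Fin n) : append h v w (Fin.cast h (Fin.natAdd m i)) = w i := by
  simp [append]

lemma append_cases {m n N : ℕ} (h : m + n = N) {P : Fin N → Prop}
    (hl : ∀ i : Fin m, P (Fin.cast h (Fin.castAdd n i)))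
    (hr : ∀ i : Fin n, P (Fin.cast h (Fin.natAdd m i))) (i : Fin N) : P i := by
  subst h
  exact Fin.addCases hl hr i

lemma comp_append {m n N : ℕ} (h : m + n = N) {R R' : Type*} (f : R → R') (v : Fin m → R)
    (w : Fin n → R) (i : Fin N) :
    f (append h v w i) = append h (fun i => f (v i)) (fun i => f (w i)) i := by
  induction i using append_cases h <;> simp [append_left, append_right]

lemma range_append {m n N : ℕ} (h : m + n = N) {R : Type*} (v : Fin m → R) (w : Fin n → R) :
    Set.range (append h v w) = Set.range v ∪ Set.range w := by
  ext x
  constructor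
  · rintro ⟨i, rfl⟩
    induction i using append_cases h <;> simp [append_left, append_right]
  · rintro (⟨i, rfl⟩ | ⟨i, rfl⟩)
    · exact ⟨_, append_left h v w i⟩
    · exact ⟨_, append_right h v w i⟩

namespace Aff

variable {m n N : ℕ} (h : m + n = N) {T T' X Y : Scheme.{u}}

/-- The morphism `T ⟶ 𝔸ᴺ_X` whose first `m` coordinates and whose component in `X` are those of
`a`, and whose last `n` coordinates are those of `b`. -/
def pair (a : T ⟶ Aff m X) (b : T ⟶ Aff n Y) : T ⟶ Aff N X :=
  lift (a ≫ pr m X) (append h (fun i => a.appTop (coord X i)) (fun i => b.appTop (coord Y i)))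

@[simp]
lemma pair_pr (a : T ⟶ Aff m X) (b : T ⟶ Aff n Y) : pair h a b ≫ pr N X = a ≫ pr m X :=
  lift_pr _ _

@[simp]
lemma pair_pr_assoc (a : T ⟶ Aff m X) (b : T ⟶ Aff n Y) (g : X ⟶ T') :
    pair h a b ≫ pr N X ≫ g = a ≫ pr m X ≫ g := by
  rw [← Category.assoc, pair_pr, Category.assoc]

lemma pair_coord (a : T ⟶ Aff m X) (b : T ⟶ Aff n Y) (i : Fin N) :
    (pair h a b).appTop (coord X i) =
      append h (fun i => a.appTop (coord X i)) (fun i => b.appTop (coord Y i)) i :=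
  lift_coord _ _ _

lemma comp_pair (c : T' ⟶ T) (a : T ⟶ Aff m X) (b : T ⟶ Aff n Y) :
    c ≫ pair h a b = pair h (c ≫ a) (c ≫ b) := by
  refine hom_ext (by simp) fun i => ?_
  rw [comp_appTop, pair_coord, pair_coord]
  exact comp_append h (fun x => c.appTop x) _ _ i

/-- The projection `𝔸ᴺ_X ⟶ 𝔸ᵐ_X` to the first `m` coordinates. -/
def proj (X : Scheme.{u}) : Aff N X ⟶ Aff m X :=
  lift (pr N X) fun i => coord X (Fin.cast h (Fin.castAdd n i))

@[simp]
lemma proj_pr : proj h X ≫ pr m X = pr N X := lift_pr _ _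

@[simp]
lemma proj_pr_assoc (g : X ⟶ T') : proj h X ≫ pr m X ≫ g = pr N X ≫ g := by
  rw [← Category.assoc, proj_pr]

@[simp]
lemma pair_proj (a : T ⟶ Aff m X) (b : T ⟶ Aff n Y) : pair h a b ≫ proj h X = a := by
  refine hom_ext (by simp) fun i => ?_
  rw [comp_appTop, proj, lift_coord, pair_coord, append_left]

@[simp]
lemma pair_proj_assoc (a : T ⟶ Aff m X) (b : T ⟶ Aff n Y) (g : Aff m X ⟶ T') :
    pair h a b ≫ proj h X ≫ g = a ≫ g := by
  rw [← Category.assoc, pair_proj]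

lemma pair_right_inj {a a' : T ⟶ Aff m X} {b b' : T ⟶ Aff n Y}
    (e : pair h a b = pair h a' b') (e' : b ≫ pr n Y = b' ≫ pr n Y) : b = b' := by
  refine hom_ext e' fun i => ?_
  have := congrArg (fun f => f.appTop (coord X (Fin.cast h (Fin.natAdd m i)))) e
  simp only [pair_coord, append_right] at this
  exact this

lemma exists_eq_pair (c : T ⟶ Aff N X) (y : T ⟶ Y) :
    ∃ b : T ⟶ Aff n Y, b ≫ pr n Y = y ∧ c = pair h (c ≫ proj h X) b := by
  refine ⟨lift y fun i => c.appTop (coord X (Fin.cast h (Fin.natAdd m i))), lift_pr _ _, ?_⟩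
  refine hom_ext (by simp) fun i => ?_
  rw [pair_coord]
  induction i using append_cases h with
  | hl i => rw [append_left, comp_appTop, proj, lift_coord]
  | hr i => rw [append_right, lift_coord]

/-- Base change of the projection `𝔸ᴺ_X ⟶ 𝔸ᵐ_X` along `p : T ⟶ 𝔸ᵐ_X` is `𝔸ⁿ_T`. -/
lemma isPullback_pair (p : T ⟶ Aff m X) (g : T ⟶ Y) :
    IsPullback (pair h (pullback.fst g (pr n Y) ≫ p) (pullback.snd g (pr n Y)))
      (pullback.fst g (pr n Y)) (proj h X) p := by
  refine ⟨⟨by simp⟩, ⟨PullbackCone.IsLimit.mk _ (fun s => ?_) ?_ ?_ ?_⟩⟩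
  · exact pullback.lift s.snd (exists_eq_pair h s.fst (s.snd ≫ g)).choose
      (exists_eq_pair h s.fst (s.snd ≫ g)).choose_spec.1.symm
  · intro s
    have := (exists_eq_pair h s.fst (s.snd ≫ g)).choose_spec.2
    rw [comp_pair]
    simp only [pullback.lift_fst_assoc, pullback.lift_snd]
    rw [← s.condition]
    exact this.symm
  · intro s
    exact pullback.lift_fst _ _ _
  · intro s f hf hf'
    refine pullback.hom_ext (by rw [hf', pullback.lift_fst]) ?_
    have h1 := (exists_eq_pair h s.fst (s.snd ≫ g)).choose_spec.2
    rw [h1, comp_pair] at hf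
    simp only [pullback.lift_snd]
    refine pair_right_inj h hf ?_
    rw [(exists_eq_pair h s.fst (s.snd ≫ g)).choose_spec.1, Category.assoc, ← pullback.condition,
      ← hf', Category.assoc]

end Aff

/-- `U ×_Y U' ⟶ 𝔸ᴺ_X` is a base change of `q` followed by a base change of `p`. -/
lemma pair_mem (P : MorphismProperty Scheme.{u})
    (hc : ∀ {A B C : Scheme.{u}} (f : A ⟶ B) (g : B ⟶ C), P f → P g → P (f ≫ g))
    (hb : ∀ {A B C D : Scheme.{u}} {f : B ⟶ D} {g : C ⟶ D} {f' : A ⟶ C} {g' : A ⟶ B},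
      IsPullback f' g' g f → P g → P g') {m n N : ℕ} (h : m + n = N) {U U' X Y : Scheme.{u}}
    (p : U ⟶ Aff m X) (g : U ⟶ Y) (q : U' ⟶ Aff n Y) (hp : P p) (hq : P q) :
    P (Aff.pair h (pullback.fst g (q ≫ Aff.pr n Y) ≫ p)
      (pullback.snd g (q ≫ Aff.pr n Y) ≫ q)) := by
  let w : pullback g (q ≫ Aff.pr n Y) ⟶ pullback g (Aff.pr n Y) :=
    pullback.lift (pullback.fst _ _) (pullback.snd _ _ ≫ q) (by simp [pullback.condition])
  have hw : IsPullback w (pullback.snd g (q ≫ Aff.pr n Y)) (pullback.snd g (Aff.pr n Y)) q := by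
    have h2 := IsPullback.of_hasPullback g (Aff.pr n Y)
    have h1 := IsPullback.of_hasPullback g (q ≫ Aff.pr n Y)
    refine IsPullback.of_right (h₁₂ := pullback.fst g (Aff.pr n Y)) (h₂₂ := Aff.pr n Y) ?_
      (pullback.lift_snd _ _ _) h2
    rw [pullback.lift_fst]
    exact h1
  have e : Aff.pair h (pullback.fst g (q ≫ Aff.pr n Y) ≫ p)
      (pullback.snd g (q ≫ Aff.pr n Y) ≫ q) =
      w ≫ Aff.pair h (pullback.fst g (Aff.pr n Y) ≫ p) (pullback.snd g (Aff.pr n Y)) := by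
    rw [Aff.comp_pair, pullback.lift_fst_assoc, pullback.lift_snd]
  rw [e]
  exact hc _ _ (hb hw.flip hq) (hb (Aff.isPullback_pair h p g).flip hp)

end FramedCorr

namespace FramedCorr
namespace ExplicitFr

variable {S : Scheme.{u}} {m n N : ℕ} {X Y T : Over S}

/-- The fibre product `U ×_Y U'` on which the composite is defined. -/
abbrev compU (a : ExplicitFr m X Y) (b : ExplicitFr n Y T) : Scheme.{u} :=
  pullback a.g (b.p ≫ Aff.pr n Y.left)

/-- The étale morphism `U ×_Y U' ⟶ 𝔸ᴺ_X` of the composite. -/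
def compP (h : m + n = N) (a : ExplicitFr m X Y) (b : ExplicitFr n Y T) :
    compU a b ⟶ Aff N X.left :=
  Aff.pair h (pullback.fst _ _ ≫ a.p) (pullback.snd _ _ ≫ b.p)

/-- The framing functions of the composite. -/
def compΦ (h : m + n = N) (a : ExplicitFr m X Y) (b : ExplicitFr n Y T) :
    Fin N → Γ(compU a b, ⊤) :=
  append h (fun i => (pullback.fst a.g (b.p ≫ Aff.pr n Y.left)).appTop (a.φ i))
    (fun i => (pullback.snd a.g (b.p ≫ Aff.pr n Y.left)).appTop (b.φ i))

/-- The points of `U ×_Y U'` lying over both supports. -/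
def compSet (a : ExplicitFr m X Y) (b : ExplicitFr n Y T) : Set (compU a b) :=
  {x | a.p (pullback.fst a.g (b.p ≫ Aff.pr n Y.left) x) ∈ a.Z ∧
    b.p (pullback.snd a.g (b.p ≫ Aff.pr n Y.left) x) ∈ b.Z}

lemma comp_aux (h : m + n = N) (a : ExplicitFr m X Y) (b : ExplicitFr n Y T) :
    ∃ (R : Scheme.{u}) (i : R ⟶ Aff N X.left) (s : R ⟶ compU a b),
      IsClosedImmersion i ∧ IsFinite (i ≫ Aff.pr N X.left) ∧
      IsPullback s (𝟙 R) (compP h a b) i ∧ Set.range s = compSet a b := by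
  obtain ⟨s₁, h₁⟩ := a.nbhd.exists_section
  obtain ⟨s₂, h₂⟩ := b.nbhd.exists_section
  have e₁ : s₁ ≫ a.p = redι a.Z := by simpa using h₁.w
  have e₂ : s₂ ≫ b.p = redι b.Z := by simpa using h₂.w
  let R := pullback (s₁ ≫ a.g) (redι b.Z ≫ Aff.pr n Y.left)
  let f₁ : R ⟶ _ := pullback.fst (s₁ ≫ a.g) (redι b.Z ≫ Aff.pr n Y.left)
  let f₂ : R ⟶ _ := pullback.snd (s₁ ≫ a.g) (redι b.Z ≫ Aff.pr n Y.left)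
  let i : R ⟶ Aff N X.left := Aff.pair h (f₁ ≫ redι a.Z) (f₂ ≫ redι b.Z)
  let s : R ⟶ compU a b := pullback.map (s₁ ≫ a.g) (redι b.Z ≫ Aff.pr n Y.left) a.g
    (b.p ≫ Aff.pr n Y.left) s₁ s₂ (𝟙 _) (by simp) (by simp [← e₂])
  have hs₁ : s ≫ pullback.fst _ _ = f₁ ≫ s₁ := pullback.lift_fst _ _ _
  have hs₂ : s ≫ pullback.snd _ _ = f₂ ≫ s₂ := pullback.lift_snd _ _ _
  have hw : s ≫ compP h a b = i := by
    rw [compP, Aff.comp_pair, reassoc_of% hs₁, reassoc_of% hs₂, e₁, e₂]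
  refine ⟨R, i, s, ?_, ?_, ⟨⟨by simpa using hw⟩, ⟨PullbackCone.IsLimit.mk _ (fun c => c.snd) ?_ ?_ ?_⟩⟩, ?_⟩
  · exact pair_mem @IsClosedImmersion (fun _ _ _ _ => inferInstance)
      IsClosedImmersion.isStableUnderBaseChange.of_isPullback h (redι a.Z) (s₁ ≫ a.g) (redι b.Z)
      inferInstance inferInstance
  · have := a.finite
    have := b.finite
    have e : i ≫ Aff.pr N X.left = f₁ ≫ redι a.Z ≫ Aff.pr m X.left := by simp [i]
    have : IsFinite f₁ :=
      (inferInstance : MorphismProperty.IsStableUnderBaseChange @IsFinite).of_isPullback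
        (IsPullback.of_hasPullback _ _).flip b.finite
    rw [e]
    infer_instance
  · intro c
    have hc := c.condition
    have k₁ : c.fst ≫ pullback.fst _ _ = c.snd ≫ f₁ ≫ s₁ := by
      have : (c.fst ≫ pullback.fst _ _) ≫ a.p = (c.snd ≫ f₁) ≫ redι a.Z := by
        have := congrArg (fun f => f ≫ Aff.proj h X.left) hc
        simpa [compP, i] using this
      have h3 := h₁.lift_snd _ _ this
      rw [Category.comp_id] at h3
      have h4 := h₁.lift_fst _ _ this
      rw [h3] at h4
      simpa using h4.symm
    refine pullback.hom_ext ?_ ?_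
    · rw [Category.assoc, hs₁, k₁]
    · have : (c.fst ≫ pullback.snd _ _) ≫ b.p = (c.snd ≫ f₂) ≫ redι b.Z := by
        change c.fst ≫ Aff.pair h _ _ = c.snd ≫ Aff.pair h _ _ at hc
        rw [Aff.comp_pair, Aff.comp_pair] at hc
        have h5 := Aff.pair_right_inj h hc (by
          rw [Category.assoc, Category.assoc, ← pullback.condition, reassoc_of% k₁,
            Category.assoc, Category.assoc, ← pullback.condition])
        simpa using h5
      have h3 := h₂.lift_snd _ _ this
      rw [Category.comp_id] at h3
      have h4 := h₂.lift_fst _ _ this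
      rw [h3] at h4
      rw [Category.assoc, hs₂]
      simpa using h4
  · intro c
    simp
  · intro c f _ hf
    simpa using hf
  · have k₁ : Set.range s₁ = a.p ⁻¹' (a.Z : Set _) := by
      rw [← range_redι]
      ext x
      constructor
      · rintro ⟨z, rfl⟩
        exact ⟨z, by rw [← Scheme.Hom.comp_apply, e₁]⟩
      · rintro ⟨z, hz⟩
        obtain ⟨w, hw, -⟩ := Scheme.exists_preimage_of_isPullback h₁ x z hz.symm
        exact ⟨w, hw⟩
    have k₂ : Set.range s₂ = b.p ⁻¹' (b.Z : Set _) := by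
      rw [← range_redι]
      ext x
      constructor
      · rintro ⟨z, rfl⟩
        exact ⟨z, by rw [← Scheme.Hom.comp_apply, e₂]⟩
      · rintro ⟨z, hz⟩
        obtain ⟨w, hw, -⟩ := Scheme.exists_preimage_of_isPullback h₂ x z hz.symm
        exact ⟨w, hw⟩
    rw [Scheme.Pullback.range_map, k₁, k₂]
    rfl

lemma mem_zeroLocus_append (h : m + n = N) {U : Scheme.{u}} (v : Fin m → Γ(U, ⊤))
    (w : Fin n → Γ(U, ⊤)) :
    U.zeroLocus (Set.range (append h v w)) =
      U.zeroLocus (Set.range v) ∩ U.zeroLocus (Set.range w) := by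
  ext x
  simp only [Scheme.mem_zeroLocus_iff, range_append, Set.mem_union, Set.mem_inter_iff]
  grind

lemma zeroLocus_appTop {U V : Scheme.{u}} (f : U ⟶ V) (v : Fin n → Γ(V, ⊤)) :
    U.zeroLocus (Set.range fun i => f.appTop (v i)) = f ⁻¹' V.zeroLocus (Set.range v) := by
  rw [Scheme.preimage_zeroLocus, ← Set.range_comp]
  rfl

lemma compP_preimage (h : m + n = N) (a : ExplicitFr m X Y) (b : ExplicitFr n Y T) :
    compP h a b ⁻¹' (compP h a b '' compSet a b) = compSet a b := by
  obtain ⟨R, i, s, -, -, hp, hr⟩ := comp_aux h a b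
  refine Set.Subset.antisymm ?_ (Set.subset_preimage_image _ _)
  rintro x ⟨y, hy, hxy⟩
  rw [← hr] at hy ⊢
  obtain ⟨z, rfl⟩ := hy
  rw [← Scheme.Hom.comp_apply, hp.w, Category.id_comp] at hxy
  obtain ⟨w, hw, -⟩ := Scheme.exists_preimage_of_isPullback hp x z hxy.symm
  exact ⟨w, hw⟩

lemma comp_support (h : m + n = N) (a : ExplicitFr m X Y) (b : ExplicitFr n Y T) :
    ∃ hZ : IsClosed (compP h a b '' compSet a b),
      IsFinite (redι ⟨compP h a b '' compSet a b, hZ⟩ ≫ Aff.pr N X.left) ∧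
      IsEtaleNbhd (compP h a b) ⟨compP h a b '' compSet a b, hZ⟩ := by
  obtain ⟨R, i, s, hi, hf, hp, hr⟩ := comp_aux h a b
  have e : compP h a b '' compSet a b = Set.range i := by
    rw [← hr, ← Set.range_comp]
    congr 1
    ext x
    rw [Function.comp_apply, ← Scheme.Hom.comp_apply, hp.w, Category.id_comp]
  have hZ : IsClosed (compP h a b '' compSet a b) := by
    rw [e]
    exact i.isClosedEmbedding.isClosed_range
  refine ⟨hZ, ?_, ?_⟩
  · obtain ⟨l, hl, hl'⟩ := exists_redι_fac i ⟨compP h a b '' compSet a b, hZ⟩ e.subset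
    rw [← hl, Category.assoc]
    infer_instance
  · exact isEtaleNbhd_of_isPullback
      (pair_mem @Etale (fun _ _ _ _ => inferInstance)
        Etale.etale_isStableUnderBaseChange.of_isPullback h _ _ _ a.nbhd.etale b.nbhd.etale)
      i e.subset s hp

/-- The composite of explicit framed correspondences `a = (Z, U, φ, g)` and
`b = (Z', U', φ', g')`: it has support (the image of) `Z ×_Y Z'`, étale neighbourhood `U ×_Y U'`,
framing functions `φ, φ'` and morphism to the target `g'`. -/
def comp (h : m + n = N) (a : ExplicitFr m X Y) (b : ExplicitFr n Y T) : ExplicitFr N X T where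
  Z := ⟨compP h a b '' compSet a b, (comp_support h a b).choose⟩
  finite := (comp_support h a b).choose_spec.1
  U := compU a b
  p := compP h a b
  nbhd := (comp_support h a b).choose_spec.2
  φ := compΦ h a b
  zeroLocus_φ := by
    rw [compΦ, mem_zeroLocus_append, zeroLocus_appTop, zeroLocus_appTop, a.zeroLocus_φ, b.zeroLocus_φ]
    exact (compP_preimage h a b).symm
  g := pullback.snd _ _ ≫ b.g
  g_over := by
    rw [Category.assoc, b.g_over, compP, Aff.pair_pr_assoc, Category.assoc, ← a.g_over,
      pullback.condition_assoc, Category.assoc]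

end ExplicitFr
end FramedCorr

namespace FramedCorr
namespace ExplicitFr

variable {S : Scheme.{u}} {m n N : ℕ} {X Y T : Over S}

lemma appTop_append (h : m + n = N) {U V : Scheme.{u}} (f : U ⟶ V) (v : Fin m → Γ(V, ⊤))
    (w : Fin n → Γ(V, ⊤)) (i : Fin N) :
    f.appTop (append h v w i) =
      append h (fun i => f.appTop (v i)) (fun i => f.appTop (w i)) i :=
  comp_append h (fun x => f.appTop x) v w i

lemma mem_comp_Z {h : m + n = N} {a : ExplicitFr m X Y} {b : ExplicitFr n Y T}
    {w : Aff N X.left} : w ∈ (comp h a b).Z ↔ ∃ u ∈ compSet a b, compP h a b u = w :=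
  Iff.rfl

lemma compP_injOn (h : m + n = N) (a : ExplicitFr m X Y) (b : ExplicitFr n Y T)
    {u v : compU a b} (hu : u ∈ compSet a b) (huv : compP h a b u = compP h a b v) : u = v :=
  (comp h a b).nbhd.injective huv ⟨u, hu, rfl⟩

lemma comp_left (h : m + n = N) {c a : ExplicitFr m X Y} (b : ExplicitFr n Y T)
    (hc : c.Restricts a) (hZ : c.Z ≤ a.Z) :
    (comp h c b).Restricts (comp h a b) ∧
      ∀ w, w ∈ (comp h c b).Z ↔ ∃ u ∈ compSet a b, compP h a b u = w ∧
        a.p (pullback.fst a.g (b.p ≫ Aff.pr n Y.left) u) ∈ c.Z := by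
  obtain ⟨j, hp, hφ, hg⟩ := hc
  let J : compU c b ⟶ compU a b := pullback.map c.g (b.p ≫ Aff.pr n Y.left) a.g
    (b.p ≫ Aff.pr n Y.left) j (𝟙 _) (𝟙 _) (by simp [hg]) (by simp)
  have h₁ : J ≫ pullback.fst _ _ = pullback.fst _ _ ≫ j := pullback.lift_fst _ _ _
  have h₂ : J ≫ pullback.snd _ _ = pullback.snd _ _ := by
    rw [← Category.comp_id (pullback.snd c.g (b.p ≫ Aff.pr n Y.left))]
    exact pullback.lift_snd _ _ _
  have q₁ : ∀ t, pullback.fst a.g (b.p ≫ Aff.pr n Y.left) (J t) =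
      j (pullback.fst c.g (b.p ≫ Aff.pr n Y.left) t) := fun t => by
    rw [← Scheme.Hom.comp_apply, h₁, Scheme.Hom.comp_apply]
  have q₂ : ∀ t, pullback.snd a.g (b.p ≫ Aff.pr n Y.left) (J t) =
      pullback.snd c.g (b.p ≫ Aff.pr n Y.left) t := fun t => by
    rw [← Scheme.Hom.comp_apply, h₂]
  have hJ : J ≫ compP h a b = compP h c b := by
    rw [compP, Aff.comp_pair, reassoc_of% h₁, reassoc_of% h₂, hp]
    rfl
  refine ⟨⟨J, hJ, fun i => ?_, ?_⟩, fun w => ⟨?_, ?_⟩⟩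
  · change J.appTop (compΦ h a b i) = compΦ h c b i
    rw [compΦ, compΦ, appTop_append]
    refine congrFun (congrArg₂ (append h) (funext fun i => ?_) (funext fun i => ?_)) i
    · rw [← Aff.comp_appTop, h₁, Aff.comp_appTop, hφ]
    · rw [← Aff.comp_appTop, h₂]
  · change J ≫ pullback.snd _ _ ≫ b.g = pullback.snd _ _ ≫ b.g
    rw [reassoc_of% h₂]
  · rintro ⟨t, ⟨ht₁, ht₂⟩, rfl⟩
    have k₁ : a.p (pullback.fst a.g (b.p ≫ Aff.pr n Y.left) (J t)) ∈ c.Z := by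
      rw [q₁, ← Scheme.Hom.comp_apply j, hp]
      exact ht₁
    have k₂ : b.p (pullback.snd a.g (b.p ≫ Aff.pr n Y.left) (J t)) ∈ b.Z := by
      rw [q₂]
      exact ht₂
    exact ⟨J t, ⟨hZ k₁, k₂⟩, by rw [← Scheme.Hom.comp_apply, hJ], k₁⟩
  · rintro ⟨u, ⟨hu₁, hu₂⟩, rfl, hu⟩
    obtain ⟨v, hv⟩ := c.nbhd.exists_preimage hu
    have hv' : j v = pullback.fst a.g (b.p ≫ Aff.pr n Y.left) u := by
      refine (a.nbhd.injective ?_ hu₁).symm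
      rw [← Scheme.Hom.comp_apply j, hp, hv]
    have : u ∈ Set.range J := by
      rw [Scheme.Pullback.range_map]
      exact ⟨⟨v, hv'⟩, ⟨_, rfl⟩⟩
    obtain ⟨t, rfl⟩ := this
    refine ⟨t, ⟨?_, ?_⟩, by rw [← Scheme.Hom.comp_apply, hJ]⟩
    · rw [q₁, ← Scheme.Hom.comp_apply j, hp] at hu
      exact hu
    · rw [q₂] at hu₂
      exact hu₂

lemma comp_right (h : m + n = N) (a : ExplicitFr m X Y) {c b : ExplicitFr n Y T}
    (hc : c.Restricts b) (hZ : c.Z ≤ b.Z) :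
    (comp h a c).Restricts (comp h a b) ∧
      ∀ w, w ∈ (comp h a c).Z ↔ ∃ u ∈ compSet a b, compP h a b u = w ∧
        b.p (pullback.snd a.g (b.p ≫ Aff.pr n Y.left) u) ∈ c.Z := by
  obtain ⟨j, hp, hφ, hg⟩ := hc
  let J : compU a c ⟶ compU a b := pullback.map a.g (c.p ≫ Aff.pr n Y.left) a.g
    (b.p ≫ Aff.pr n Y.left) (𝟙 _) j (𝟙 _) (by simp) (by simp [← hp])
  have h₁ : J ≫ pullback.fst _ _ = pullback.fst _ _ := by
    rw [← Category.comp_id (pullback.fst a.g (c.p ≫ Aff.pr n Y.left))]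
    exact pullback.lift_fst _ _ _
  have h₂ : J ≫ pullback.snd _ _ = pullback.snd _ _ ≫ j := pullback.lift_snd _ _ _
  have q₁ : ∀ t, pullback.fst a.g (b.p ≫ Aff.pr n Y.left) (J t) =
      pullback.fst a.g (c.p ≫ Aff.pr n Y.left) t := fun t => by
    rw [← Scheme.Hom.comp_apply, h₁]
  have q₂ : ∀ t, pullback.snd a.g (b.p ≫ Aff.pr n Y.left) (J t) =
      j (pullback.snd a.g (c.p ≫ Aff.pr n Y.left) t) := fun t => by
    rw [← Scheme.Hom.comp_apply, h₂, Scheme.Hom.comp_apply]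
  have hJ : J ≫ compP h a b = compP h a c := by
    rw [compP, Aff.comp_pair, reassoc_of% h₁, reassoc_of% h₂, hp]
    rfl
  refine ⟨⟨J, hJ, fun i => ?_, ?_⟩, fun w => ⟨?_, ?_⟩⟩
  · change J.appTop (compΦ h a b i) = compΦ h a c i
    rw [compΦ, compΦ, appTop_append]
    refine congrFun (congrArg₂ (append h) (funext fun i => ?_) (funext fun i => ?_)) i
    · rw [← Aff.comp_appTop, h₁]
    · rw [← Aff.comp_appTop, h₂, Aff.comp_appTop, hφ]
  · change J ≫ pullback.snd _ _ ≫ b.g = pullback.snd _ _ ≫ c.g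
    rw [reassoc_of% h₂, hg]
  · rintro ⟨t, ⟨ht₁, ht₂⟩, rfl⟩
    have k₁ : a.p (pullback.fst a.g (b.p ≫ Aff.pr n Y.left) (J t)) ∈ a.Z := by
      rw [q₁]
      exact ht₁
    have k₂ : b.p (pullback.snd a.g (b.p ≫ Aff.pr n Y.left) (J t)) ∈ c.Z := by
      rw [q₂, ← Scheme.Hom.comp_apply j, hp]
      exact ht₂
    exact ⟨J t, ⟨k₁, hZ k₂⟩, by rw [← Scheme.Hom.comp_apply, hJ], k₂⟩
  · rintro ⟨u, ⟨hu₁, hu₂⟩, rfl, hu⟩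
    obtain ⟨v, hv⟩ := c.nbhd.exists_preimage hu
    have hv' : j v = pullback.snd a.g (b.p ≫ Aff.pr n Y.left) u := by
      refine (b.nbhd.injective ?_ hu₂).symm
      rw [← Scheme.Hom.comp_apply j, hp, hv]
    have : u ∈ Set.range J := by
      rw [Scheme.Pullback.range_map]
      exact ⟨⟨_, rfl⟩, ⟨v, hv'⟩⟩
    obtain ⟨t, rfl⟩ := this
    refine ⟨t, ⟨?_, ?_⟩, by rw [← Scheme.Hom.comp_apply, hJ]⟩
    · rw [q₁] at hu₁
      exact hu₁
    · rw [q₂, ← Scheme.Hom.comp_apply j, hp] at hu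
      exact hu

lemma comp_Z_left (h : m + n = N) {c a : ExplicitFr m X Y} (b : ExplicitFr n Y T)
    (hc : c.Restricts a) (hZ : c.Z = a.Z) : (comp h c b).Z = (comp h a b).Z := by
  refine SetLike.ext fun w => ?_
  rw [(comp_left h b hc hZ.le).2, mem_comp_Z, hZ]
  exact ⟨fun ⟨u, hu, e, _⟩ => ⟨u, hu, e⟩, fun ⟨u, hu, e⟩ => ⟨u, hu, e, hu.1⟩⟩

lemma comp_Z_right (h : m + n = N) (a : ExplicitFr m X Y) {c b : ExplicitFr n Y T}
    (hc : c.Restricts b) (hZ : c.Z = b.Z) : (comp h a c).Z = (comp h a b).Z := by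
  refine SetLike.ext fun w => ?_
  rw [(comp_right h a hc hZ.le).2, mem_comp_Z, hZ]
  exact ⟨fun ⟨u, hu, e, _⟩ => ⟨u, hu, e⟩, fun ⟨u, hu, e⟩ => ⟨u, hu, e, hu.2⟩⟩

lemma Equivalent.comp_left (h : m + n = N) {a a' : ExplicitFr m X Y} (b : ExplicitFr n Y T)
    (e : a.Equivalent a') : (comp h a b).Equivalent (comp h a' b) := by
  obtain ⟨c, hZ, hZ', hc, hc'⟩ := e
  exact ⟨comp h c b, comp_Z_left h b hc hZ, comp_Z_left h b hc' hZ',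
    (ExplicitFr.comp_left h b hc hZ.le).1, (ExplicitFr.comp_left h b hc' hZ'.le).1⟩

lemma Equivalent.comp_right (h : m + n = N) (a : ExplicitFr m X Y) {b b' : ExplicitFr n Y T}
    (e : b.Equivalent b') : (comp h a b).Equivalent (comp h a b') := by
  obtain ⟨c, hZ, hZ', hc, hc'⟩ := e
  exact ⟨comp h a c, comp_Z_right h a hc hZ, comp_Z_right h a hc' hZ',
    (ExplicitFr.comp_right h a hc hZ.le).1, (ExplicitFr.comp_right h a hc' hZ'.le).1⟩

lemma IsDisjointSum.comp_left (h : m + n = N) {a a₁ a₂ : ExplicitFr m X Y}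
    (b : ExplicitFr n Y T) (e : a.IsDisjointSum a₁ a₂) :
    (comp h a b).IsDisjointSum (comp h a₁ b) (comp h a₂ b) := by
  obtain ⟨hZ, hd, h₁, h₂⟩ := e
  obtain ⟨r₁, k₁⟩ := ExplicitFr.comp_left h b h₁ (hZ ▸ le_sup_left)
  obtain ⟨r₂, k₂⟩ := ExplicitFr.comp_left h b h₂ (hZ ▸ le_sup_right)
  refine ⟨SetLike.ext fun w => ?_, ?_, r₁, r₂⟩
  · change _ ↔ w ∈ (comp h a₁ b).Z ∨ w ∈ (comp h a₂ b).Z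
    rw [k₁, k₂, mem_comp_Z]
    constructor
    · rintro ⟨u, hu, e⟩
      have := hu.1
      rw [hZ] at this
      exact this.imp (fun h => ⟨u, hu, e, h⟩) (fun h => ⟨u, hu, e, h⟩)
    · rintro (⟨u, hu, e, -⟩ | ⟨u, hu, e, -⟩) <;> exact ⟨u, hu, e⟩
  · rw [Set.disjoint_left] at hd ⊢
    intro w hw hw'
    obtain ⟨u, hu, rfl, hu'⟩ := (k₁ w).1 hw
    obtain ⟨v, hv, e, hv'⟩ := (k₂ _).1 hw'
    obtain rfl := compP_injOn h a b hv e
    exact hd hu' hv'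

lemma IsDisjointSum.comp_right (h : m + n = N) (a : ExplicitFr m X Y)
    {b b₁ b₂ : ExplicitFr n Y T} (e : b.IsDisjointSum b₁ b₂) :
    (comp h a b).IsDisjointSum (comp h a b₁) (comp h a b₂) := by
  obtain ⟨hZ, hd, h₁, h₂⟩ := e
  obtain ⟨r₁, k₁⟩ := ExplicitFr.comp_right h a h₁ (hZ ▸ le_sup_left)
  obtain ⟨r₂, k₂⟩ := ExplicitFr.comp_right h a h₂ (hZ ▸ le_sup_right)
  refine ⟨SetLike.ext fun w => ?_, ?_, r₁, r₂⟩
  · change _ ↔ w ∈ (comp h a b₁).Z ∨ w ∈ (comp h a b₂).Z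
    rw [k₁, k₂, mem_comp_Z]
    constructor
    · rintro ⟨u, hu, e⟩
      have := hu.2
      rw [hZ] at this
      exact this.imp (fun h => ⟨u, hu, e, h⟩) (fun h => ⟨u, hu, e, h⟩)
    · rintro (⟨u, hu, e, -⟩ | ⟨u, hu, e, -⟩) <;> exact ⟨u, hu, e⟩
  · rw [Set.disjoint_left] at hd ⊢
    intro w hw hw'
    obtain ⟨u, hu, rfl, hu'⟩ := (k₁ w).1 hw
    obtain ⟨v, hv, e, hv'⟩ := (k₂ _).1 hw'
    obtain rfl := compP_injOn h a b hv e
    exact hd hu' hv'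

/-- Isomorphic data define equivalent framed correspondences. -/
lemma equivalent_of_surjective {c a : ExplicitFr n X Y} (j : c.U ⟶ a.U)
    (hj : Function.Surjective j) (hp : j ≫ a.p = c.p) (hφ : ∀ i, j.appTop (a.φ i) = c.φ i)
    (hg : j ≫ a.g = c.g) : c.Equivalent a := by
  refine ⟨c, rfl, SetLike.ext fun w => ?_, ⟨𝟙 _, by simp, by simp, by simp⟩, ⟨j, hp, hφ, hg⟩⟩
  have key : j ⁻¹' (a.p ⁻¹' (a.Z : Set _)) = c.p ⁻¹' (c.Z : Set _) := by
    rw [← a.zeroLocus_φ, ← c.zeroLocus_φ, ← zeroLocus_appTop]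
    simp only [hφ]
  constructor
  · intro hw
    obtain ⟨x, rfl⟩ := c.nbhd.exists_preimage hw
    have : x ∈ j ⁻¹' (a.p ⁻¹' (a.Z : Set _)) := key ▸ hw
    rw [← hp]
    simpa using this
  · intro hw
    obtain ⟨x, rfl⟩ := a.nbhd.exists_preimage hw
    obtain ⟨y, rfl⟩ := hj x
    have : y ∈ c.p ⁻¹' (c.Z : Set _) := key ▸ hw
    rw [← hp] at this
    simpa using this

end ExplicitFr

/-- The set `Frₙ(X, Y)` of framed correspondences of level `n`. -/
def Fr {S : Scheme.{u}} (n : ℕ) (X Y : Over S) : Type (u + 1) :=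
  Quot (ExplicitFr.Equivalent (n := n) (X := X) (Y := Y))

/-- The universal property of `Frₙ(X, Y)`. -/
def Fr.lift {S : Scheme.{u}} {n : ℕ} {X Y : Over S} {A : Type*} (f : ExplicitFr n X Y → A)
    (h : ∀ a b, a.Equivalent b → f a = f b) : Fr n X Y → A :=
  Quot.lift f h

/-- The class in `Frₙ(X, Y)` of an explicit framed correspondence. -/
def ExplicitFr.toFr {S : Scheme.{u}} {n : ℕ} {X Y : Over S} (a : ExplicitFr n X Y) : Fr n X Y :=
  Quot.mk _ a

/-- The subgroup of `ℤFrₙ(X, Y)` generated by the elements `a - a₁ - a₂`, where the support of `a`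
is the disjoint union of those of `a₁` and `a₂`. -/
def additivitySubgroup {S : Scheme.{u}} (n : ℕ) (X Y : Over S) :
    AddSubgroup (FreeAbelianGroup (Fr n X Y)) :=
  AddSubgroup.closure {x | ∃ a a₁ a₂ : ExplicitFr n X Y, a.IsDisjointSum a₁ a₂ ∧
    x = FreeAbelianGroup.of a.toFr - FreeAbelianGroup.of a₁.toFr - FreeAbelianGroup.of a₂.toFr}

/-- The group `ℤFₙ(X, Y)` of linear framed correspondences of level `n`. -/
abbrev ZF {S : Scheme.{u}} (n : ℕ) (X Y : Over S) : Type (u + 1) :=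
  FreeAbelianGroup (Fr n X Y) ⧸ additivitySubgroup n X Y

namespace ZF

variable {S : Scheme.{u}} {m n N : ℕ} {X Y T : Over S}

/-- The class `⟨a⟩` in `ℤFₙ(X, Y)` of an explicit framed correspondence. -/
def mk (a : ExplicitFr n X Y) : ZF n X Y :=
  QuotientAddGroup.mk (FreeAbelianGroup.of a.toFr)

lemma mk_eq_of_equivalent {a b : ExplicitFr n X Y} (h : a.Equivalent b) : mk a = mk b :=
  congrArg (fun x => QuotientAddGroup.mk (FreeAbelianGroup.of x)) (Quot.sound h)

lemma mk_eq_add {a a₁ a₂ : ExplicitFr n X Y} (h : a.IsDisjointSum a₁ a₂) :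
    mk a = mk a₁ + mk a₂ := by
  have : FreeAbelianGroup.of a.toFr - FreeAbelianGroup.of a₁.toFr - FreeAbelianGroup.of a₂.toFr ∈
      additivitySubgroup n X Y := AddSubgroup.subset_closure ⟨a, a₁, a₂, h, rfl⟩
  rw [← QuotientAddGroup.eq_zero_iff] at this
  have h2 : mk a - mk a₁ - mk a₂ = 0 := this
  rw [sub_sub, sub_eq_zero] at h2
  exact h2

/-- The universal property of `ℤFₙ(X, Y)`. -/
def lift {A : Type*} [AddCommGroup A] (f : ExplicitFr n X Y → A)
    (h : ∀ a b, a.Equivalent b → f a = f b)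
    (h' : ∀ a a₁ a₂, a.IsDisjointSum a₁ a₂ → f a = f a₁ + f a₂) : ZF n X Y →+ A :=
  QuotientAddGroup.lift _ (FreeAbelianGroup.lift (Fr.lift f h)) (by
    rw [additivitySubgroup, AddSubgroup.closure_le]
    rintro x ⟨a, a₁, a₂, e, rfl⟩
    change FreeAbelianGroup.lift (Fr.lift f h) _ = 0
    rw [map_sub, map_sub, FreeAbelianGroup.lift_apply_of, FreeAbelianGroup.lift_apply_of,
      FreeAbelianGroup.lift_apply_of]
    change f a - f a₁ - f a₂ = 0
    rw [h' a a₁ a₂ e]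
    abel)

@[simp]
lemma lift_mk {A : Type*} [AddCommGroup A] (f : ExplicitFr n X Y → A)
    (h : ∀ a b, a.Equivalent b → f a = f b)
    (h' : ∀ a a₁ a₂, a.IsDisjointSum a₁ a₂ → f a = f a₁ + f a₂) (a : ExplicitFr n X Y) :
    lift f h h' (mk a) = f a := by
  change FreeAbelianGroup.lift (Fr.lift f h) (FreeAbelianGroup.of a.toFr) = f a
  rw [FreeAbelianGroup.lift_apply_of]
  rfl

lemma hom_ext {A : Type*} [AddCommGroup A] {f g : ZF n X Y →+ A}
    (h : ∀ a, f (mk a) = g (mk a)) : f = g := by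
  refine QuotientAddGroup.addMonoidHom_ext _ (FreeAbelianGroup.lift_ext _ _ fun a => ?_)
  induction a using Quot.ind with
  | mk a => exact h a

/-- Composition of framed correspondences (in diagrammatic order), as a biadditive map
`ℤFₘ(X, Y) × ℤFₙ(Y, T) → ℤF_N(X, T)`, where `N = m + n`. -/
def comp (h : m + n = N) : ZF m X Y →+ ZF n Y T →+ ZF N X T :=
  lift (fun a => lift (fun b => mk (a.comp h b))
      (fun _ _ e => mk_eq_of_equivalent (e.comp_right h a))
      (fun _ _ _ e => mk_eq_add (e.comp_right h a)))
    (fun a a' e => hom_ext fun b => by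
      rw [lift_mk, lift_mk]
      exact mk_eq_of_equivalent (e.comp_left h b))
    (fun a a₁ a₂ e => hom_ext fun b => by
      rw [AddMonoidHom.add_apply, lift_mk, lift_mk, lift_mk]
      exact mk_eq_add (e.comp_left h b))

@[simp]
lemma comp_mk (h : m + n = N) (a : ExplicitFr m X Y) (b : ExplicitFr n Y T) :
    comp h (mk a) (mk b) = mk (a.comp h b) := by
  simp [comp]

end ZF
end FramedCorr

namespace FramedCorr

lemma append_assoc {m n l p q N : ℕ} (h₁ : m + n = p) (h₂ : p + l = N) (h₃ : n + l = q)
    (h₄ : m + q = N) {R : Type*} (u : Fin m → R) (v : Fin n → R) (w : Fin l → R) :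
    append h₂ (append h₁ u v) w = append h₄ u (append h₃ v w) := by
  subst h₁ h₃ h₂
  funext i
  have e₁ : append rfl u v = Fin.append u v := rfl
  have e₂ : append rfl v w = Fin.append v w := rfl
  have := congrFun (Fin.append_assoc u v w) i
  rw [e₁, e₂]
  exact this

lemma Aff.pair_assoc {m n l p q N : ℕ} (h₁ : m + n = p) (h₂ : p + l = N) (h₃ : n + l = q)
    (h₄ : m + q = N) {T X Y Y' : Scheme.{u}} (a : T ⟶ Aff m X) (b : T ⟶ Aff n Y)
    (c : T ⟶ Aff l Y') :
    Aff.pair h₂ (Aff.pair h₁ a b) c = Aff.pair h₄ a (Aff.pair h₃ b c) := by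
  refine Aff.hom_ext (by simp) fun i => ?_
  simp only [Aff.pair_coord]
  exact congrFun (append_assoc h₁ h₂ h₃ h₄ _ _ _) i

namespace ExplicitFr

variable {S : Scheme.{u}} {m n l p q N : ℕ} {X Y T R : Over S}

lemma comp_assoc (h₁ : m + n = p) (h₂ : p + l = N) (h₃ : n + l = q) (h₄ : m + q = N)
    (a : ExplicitFr m X Y) (b : ExplicitFr n Y T) (c : ExplicitFr l T R) :
    ((a.comp h₁ b).comp h₂ c).Equivalent (a.comp h₄ (b.comp h₃ c)) := by
  have w₁ := pullback.condition (f := a.g) (g := b.p ≫ Aff.pr n Y.left)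
  have w₂ := pullback.condition (f := b.g) (g := c.p ≫ Aff.pr l T.left)
  have w₃ : pullback.fst _ _ ≫ pullback.snd a.g (b.p ≫ Aff.pr n Y.left) ≫ b.g =
      pullback.snd (a.comp h₁ b).g (c.p ≫ Aff.pr l T.left) ≫ c.p ≫ Aff.pr l T.left :=
    pullback.condition (f := (a.comp h₁ b).g) (g := c.p ≫ Aff.pr l T.left)
  have w₄ : pullback.fst a.g ((b.comp h₃ c).p ≫ Aff.pr q Y.left) ≫ a.g =
      pullback.snd _ _ ≫ pullback.fst b.g (c.p ≫ Aff.pr l T.left) ≫ b.p ≫ Aff.pr n Y.left :=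
    pullback.condition.trans
      (congrArg (fun f => _ ≫ f) ((Aff.pair_pr h₃ _ _).trans (Category.assoc _ _ _)))
  let F₁ : compU (a.comp h₁ b) c ⟶ compU a b := pullback.fst _ _
  let F₂ : compU (a.comp h₁ b) c ⟶ c.U := pullback.snd _ _
  let G₁ : compU a (b.comp h₃ c) ⟶ a.U := pullback.fst _ _
  let G₂ : compU a (b.comp h₃ c) ⟶ compU b c := pullback.snd _ _
  let j' : compU (a.comp h₁ b) c ⟶ compU b c :=
    pullback.lift (F₁ ≫ pullback.snd _ _) F₂ ((Category.assoc _ _ _).trans w₃)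
  have j'₁ : j' ≫ pullback.fst _ _ = F₁ ≫ pullback.snd _ _ := pullback.lift_fst _ _ _
  have j'₂ : j' ≫ pullback.snd _ _ = F₂ := pullback.lift_snd _ _ _
  let j : compU (a.comp h₁ b) c ⟶ compU a (b.comp h₃ c) :=
    pullback.lift (F₁ ≫ pullback.fst _ _) j' (by
      change _ = j' ≫ Aff.pair h₃ _ _ ≫ _
      rw [Aff.pair_pr, Category.assoc, Category.assoc, reassoc_of% j'₁, w₁])
  have j₁ : j ≫ G₁ = F₁ ≫ pullback.fst _ _ := pullback.lift_fst _ _ _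
  have j₂ : j ≫ G₂ = j' := pullback.lift_snd _ _ _
  let k' : compU a (b.comp h₃ c) ⟶ compU a b :=
    pullback.lift G₁ (G₂ ≫ pullback.fst _ _) (w₄.trans (Category.assoc _ _ _).symm)
  have k'₁ : k' ≫ pullback.fst _ _ = G₁ := pullback.lift_fst _ _ _
  have k'₂ : k' ≫ pullback.snd _ _ = G₂ ≫ pullback.fst _ _ := pullback.lift_snd _ _ _
  let k : compU a (b.comp h₃ c) ⟶ compU (a.comp h₁ b) c :=
    pullback.lift k' (G₂ ≫ pullback.snd _ _) (by
      change k' ≫ pullback.snd _ _ ≫ b.g = _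
      rw [reassoc_of% k'₂, Category.assoc, w₂])
  have k₁ : k ≫ F₁ = k' := pullback.lift_fst _ _ _
  have k₂ : k ≫ F₂ = G₂ ≫ pullback.snd _ _ := pullback.lift_snd _ _ _
  have hkj : k ≫ j = 𝟙 _ := by
    have e₁ : (k ≫ j) ≫ G₁ = G₁ := by
      rw [Category.assoc, j₁, reassoc_of% k₁, k'₁]
    have e₂ : (k ≫ j) ≫ G₂ = G₂ := by
      rw [Category.assoc, j₂]
      refine pullback.hom_ext ?_ ?_
      · rw [Category.assoc, j'₁, reassoc_of% k₁, k'₂]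
      · rw [Category.assoc, j'₂, k₂]
    exact pullback.hom_ext (e₁.trans (Category.id_comp _).symm) (e₂.trans (Category.id_comp _).symm)
  have hj : Function.Surjective j := fun x =>
    ⟨k x, by rw [← Scheme.Hom.comp_apply, hkj]; rfl⟩
  refine equivalent_of_surjective (c := (a.comp h₁ b).comp h₂ c) (a := a.comp h₄ (b.comp h₃ c)) j
    hj ?_ (fun i => ?_) ?_
  · change j ≫ Aff.pair h₄ (G₁ ≫ a.p) (G₂ ≫ Aff.pair h₃ (pullback.fst _ _ ≫ b.p)
      (pullback.snd _ _ ≫ c.p)) = Aff.pair h₂ (F₁ ≫ Aff.pair h₁ (pullback.fst _ _ ≫ a.p)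
      (pullback.snd _ _ ≫ b.p)) (F₂ ≫ c.p)
    simp only [Aff.comp_pair]
    rw [Aff.pair_assoc h₁ h₂ h₃ h₄, reassoc_of% j₁, reassoc_of% j₂, reassoc_of% j'₁,
      reassoc_of% j₂, reassoc_of% j'₂]
  · change j.appTop (append h₄ (fun i => G₁.appTop (a.φ i)) (fun i => G₂.appTop (append h₃
        (fun i => (pullback.fst b.g (c.p ≫ Aff.pr l T.left)).appTop (b.φ i))
        (fun i => (pullback.snd b.g (c.p ≫ Aff.pr l T.left)).appTop (c.φ i)) i)) i) =
      append h₂ (fun i => F₁.appTop (append h₁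
        (fun i => (pullback.fst a.g (b.p ≫ Aff.pr n Y.left)).appTop (a.φ i))
        (fun i => (pullback.snd a.g (b.p ≫ Aff.pr n Y.left)).appTop (b.φ i)) i))
        (fun i => F₂.appTop (c.φ i)) i
    simp only [appTop_append, ← Aff.comp_appTop]
    change _ = append h₂ (append h₁ _ _) _ i
    rw [append_assoc h₁ h₂ h₃ h₄, j₁, reassoc_of% j₂, j'₁, reassoc_of% j₂, j'₂]
  · change j ≫ G₂ ≫ pullback.snd _ _ ≫ c.g = F₂ ≫ c.g
    rw [reassoc_of% j₂, reassoc_of% j'₂]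

end ExplicitFr

lemma ZF.induction {S : Scheme.{u}} {n : ℕ} {X Y : Over S} {P : ZF n X Y → Prop}
    (hzero : P 0) (hmk : ∀ a, P (mk a)) (hneg : ∀ x, P x → P (-x)) (hadd : ∀ x y, P x → P y → P (x + y))
    (x : ZF n X Y) : P x := by
  obtain ⟨x, rfl⟩ := QuotientAddGroup.mk_surjective x
  have hof : ∀ a : Fr n X Y, P (QuotientAddGroup.mk (FreeAbelianGroup.of a)) := fun a =>
    Quot.ind (β := fun a => P (QuotientAddGroup.mk (FreeAbelianGroup.of a))) hmk a
  induction x using FreeAbelianGroup.induction_on with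
  | zero => exact hzero
  | of a => exact hof a
  | neg a _ => exact hneg _ (hof a)
  | add x y hx hy => exact hadd _ _ hx hy

lemma ZF.comp_assoc {S : Scheme.{u}} {m n l p q N : ℕ} {X Y T R : Over S}
    (h₁ : m + n = p) (h₂ : p + l = N) (h₃ : n + l = q) (h₄ : m + q = N)
    (a : ZF m X Y) (b : ZF n Y T) (c : ZF l T R) :
    comp h₂ (comp h₁ a b) c = comp h₄ a (comp h₃ b c) := by
  induction a using ZF.induction with
  | hzero => simp
  | hneg x hx => simp [hx]
  | hadd x y hx hy => simp [hx, hy]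
  | hmk a =>
  induction b using ZF.induction with
  | hzero => simp
  | hneg x hx => simp [hx]
  | hadd x y hx hy => simp [hx, hy]
  | hmk b =>
  induction c using ZF.induction with
  | hzero => simp
  | hneg x hx => rw [map_neg, map_neg, map_neg, hx]
  | hadd x y hx hy => rw [map_add, map_add, map_add, hx, hy]
  | hmk c =>
  rw [comp_mk, comp_mk, comp_mk, comp_mk]
  exact mk_eq_of_equivalent (a.comp_assoc h₁ h₂ h₃ h₄ b c)

end FramedCorr

namespace FramedCorr

/-! ### Morphisms and `σ` as framed correspondences -/

lemma isEtaleNbhd_id {B : Scheme.{u}} (Z : Closeds B) : IsEtaleNbhd (𝟙 B) Z :=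
  ⟨inferInstance, inferInstance⟩

lemma zeroLocus_coord_subset (n : ℕ) (X : Scheme.{u}) :
    (Aff n X).zeroLocus (Set.range (Aff.coord (n := n) X)) ⊆
      Set.range (Aff.lift (n := n) (𝟙 X) 0) := by
  intro w hw
  let e := (Aff n X).fromSpecResidueField w
  have h0 : ∀ i, e.appTop (Aff.coord X i) = 0 := by
    intro i
    rw [← basicOpen_eq_bot_iff, ← Scheme.preimage_basicOpen_top]
    rw [Scheme.mem_zeroLocus_iff] at hw
    refine le_bot_iff.1 fun y hy => ?_
    have : e y = w := by simp [e]
    exact (hw _ ⟨i, rfl⟩ (this ▸ hy)).elim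
  have he : e = (e ≫ Aff.pr n X) ≫ Aff.lift (𝟙 X) 0 := by
    refine Aff.hom_ext (by simp) fun i => ?_
    rw [h0, Aff.comp_appTop, Aff.lift_coord]
    simp
  obtain ⟨y⟩ : Nonempty (Spec ((Aff n X).residueField w)) := inferInstance
  refine ⟨(e ≫ Aff.pr n X) y, ?_⟩
  rw [← Scheme.Hom.comp_apply, ← he]
  simp [e]

namespace ExplicitFr

variable {S : Scheme.{u}} {n : ℕ}

/-- The explicit framed correspondence of level `0` with support all of `𝔸⁰_X = X` given by a
morphism `f`. -/
def ofHom {X Y : Over S} (f : X ⟶ Y) : ExplicitFr 0 X Y where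
  Z := ⊤
  finite := inferInstance
  U := Aff 0 X.left
  p := 𝟙 _
  nbhd := isEtaleNbhd_id _
  φ := Fin.elim0
  zeroLocus_φ := by
    rw [Set.range_eq_empty, Scheme.zeroLocus_empty_eq_univ]
    rfl
  g := Aff.pr 0 X.left ≫ f.left
  g_over := by simp

/-- The explicit framed correspondence `σ_X = (X × 0, X × 𝔸¹, t; pr_X)` of level `1`. -/
def sigma (X : Over S) : ExplicitFr 1 X X where
  Z := ⟨(Aff 1 X.left).zeroLocus (Set.range (Aff.coord X.left)), Scheme.zeroLocus_isClosed _ _⟩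
  finite := by
    have : IsClosedImmersion (Aff.lift (n := 1) (𝟙 X.left) 0 ≫ Aff.pr 1 X.left) := by
      rw [Aff.lift_pr]; infer_instance
    have : IsClosedImmersion (Aff.lift (n := 1) (𝟙 X.left) 0) :=
      IsClosedImmersion.of_comp _ (Aff.pr 1 X.left)
    obtain ⟨l, hl, hl'⟩ := exists_redι_fac (Aff.lift (n := 1) (𝟙 X.left) 0)
      ⟨(Aff 1 X.left).zeroLocus (Set.range (Aff.coord X.left)), Scheme.zeroLocus_isClosed _ _⟩
      (zeroLocus_coord_subset 1 X.left)
    rw [← hl, Category.assoc, Aff.lift_pr, Category.comp_id]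
    infer_instance
  U := Aff 1 X.left
  p := 𝟙 _
  nbhd := isEtaleNbhd_id _
  φ := Aff.coord X.left
  zeroLocus_φ := rfl
  g := Aff.pr 1 X.left
  g_over := by simp

variable {m N : ℕ} {X Y T : Over S}

lemma compP_surjective (h : m + n = N) (a : ExplicitFr m X Y) (b : ExplicitFr n Y T)
    (ha : Surjective a.p) (hb : Surjective b.p) : Function.Surjective (compP h a b) :=
  (pair_mem @Surjective (fun _ _ _ _ => inferInstance)
    (inferInstance : MorphismProperty.IsStableUnderBaseChange @Surjective).of_isPullback
    h a.p a.g b.p ha hb).surj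

/-- Replacing the morphism to the target by its composite with `f`. -/
def push (a : ExplicitFr n X Y) (f : Y ⟶ T) : ExplicitFr n X T where
  Z := a.Z
  finite := a.finite
  U := a.U
  p := a.p
  nbhd := a.nbhd
  φ := a.φ
  zeroLocus_φ := a.zeroLocus_φ
  g := a.g ≫ f.left
  g_over := by simp [a.g_over]

lemma append_zero {R : Type*} (v : Fin n → R) (w : Fin 0 → R) : append (add_zero n) v w = v := by
  funext i
  induction i using append_cases (add_zero n) with
  | hl i => rw [append_left]; rfl
  | hr i => exact i.elim0

lemma zero_append {R : Type*} (v : Fin 0 → R) (w : Fin n → R) (i : Fin n) :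
    append (zero_add n) v w i = w i := by
  induction i using append_cases (zero_add n) with
  | hl i => exact i.elim0
  | hr i =>
    rw [append_right]
    congr 1
    exact Fin.ext (Nat.zero_add _).symm

lemma comp_ofHom (a : ExplicitFr n X Y) (f : Y ⟶ T) :
    (comp (add_zero n) a (ofHom f)).Equivalent (a.push f) := by
  have e : IsIso ((ofHom f).p ≫ Aff.pr 0 Y.left) := by
    change IsIso (𝟙 _ ≫ Aff.pr 0 Y.left)
    infer_instance
  have w : pullback.fst a.g ((ofHom f).p ≫ Aff.pr 0 Y.left) ≫ a.g =
      pullback.snd _ _ ≫ 𝟙 _ ≫ Aff.pr 0 Y.left := pullback.condition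
  rw [Category.id_comp] at w
  refine equivalent_of_surjective (c := comp (add_zero n) a (ofHom f)) (a := a.push f)
    (pullback.fst a.g ((ofHom f).p ≫ Aff.pr 0 Y.left)) ?_ ?_ (fun i => ?_) ?_
  · exact (pullback.fst a.g ((ofHom f).p ≫ Aff.pr 0 Y.left)).surjective
  · change pullback.fst a.g ((ofHom f).p ≫ Aff.pr 0 Y.left) ≫ a.p = Aff.pair _ _ _
    refine Aff.hom_ext (by rw [Aff.pair_pr]) fun i => ?_
    rw [Aff.pair_coord, append_zero]
  · change _ = compΦ (add_zero n) a (ofHom f) i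
    rw [compΦ, append_zero]
    rfl
  · exact (Category.assoc _ _ _).symm.trans
      ((congrArg (fun t => t ≫ f.left) w).trans (Category.assoc _ _ _))

lemma pair_zero_pr {B X Y : Scheme.{u}} (a : B ⟶ Aff 0 X) (b : B ⟶ Aff 1 Y) (f : X ⟶ Y)
    (w : a ≫ Aff.pr 0 X ≫ f = b ≫ 𝟙 _ ≫ Aff.pr 1 Y) :
    Aff.pair (zero_add 1) (a ≫ 𝟙 _) (b ≫ 𝟙 _) ≫ Aff.pr 1 X ≫ f = b ≫ Aff.pr 1 Y := by
  rw [Aff.pair_pr_assoc, Category.comp_id, w, Category.id_comp]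

lemma pair_zero_coord {B X Y : Scheme.{u}} (a : B ⟶ Aff 0 X) (b : B ⟶ Aff 1 Y) (i : Fin 1) :
    (Aff.pair (zero_add 1) (a ≫ 𝟙 _) (b ≫ 𝟙 _)).appTop (Aff.coord X i) =
      append (zero_add 1) (fun i => a.appTop (Fin.elim0 i)) (fun i => b.appTop (Aff.coord Y i)) i := by
  rw [Aff.pair_coord, zero_append, zero_append, Category.comp_id]

lemma comp_ofHom_sigma (f : X ⟶ Y) :
    (comp (zero_add 1) (ofHom f) (sigma Y)).Equivalent ((sigma X).push f) := by
  have w : pullback.fst (ofHom f).g ((sigma Y).p ≫ Aff.pr 1 Y.left) ≫ Aff.pr 0 X.left ≫ f.left =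
      pullback.snd _ _ ≫ 𝟙 _ ≫ Aff.pr 1 Y.left := pullback.condition
  refine equivalent_of_surjective (c := comp (zero_add 1) (ofHom f) (sigma Y))
    (a := (sigma X).push f) (compP (zero_add 1) (ofHom f) (sigma Y))
    (compP_surjective _ _ _ (inferInstanceAs (Surjective (𝟙 (Aff 0 X.left))))
      (inferInstanceAs (Surjective (𝟙 (Aff 1 Y.left))))) (Category.comp_id _) (fun i => ?_) ?_
  · exact pair_zero_coord _ _ i
  · exact pair_zero_pr _ _ _ w

end ExplicitFr

namespace ZF

variable {S : Scheme.{u}} {X Y T : Over S} {n : ℕ}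

/-- The class `⟨f⟩` in `ℤF₀(X, Y)` of a morphism `f`. -/
def ofHom (f : X ⟶ Y) : ZF 0 X Y := mk (.ofHom f)

/-- The class `⟨σ_X⟩` in `ℤF₁(X, X)`. -/
def sigma (X : Over S) : ZF 1 X X := mk (.sigma X)

lemma comp_ofHom_ofHom (f : X ⟶ Y) (g : Y ⟶ T) :
    comp (add_zero 0) (ofHom f) (ofHom g) = ofHom (f ≫ g) := by
  rw [ofHom, ofHom, comp_mk, mk_eq_of_equivalent (ExplicitFr.comp_ofHom _ g)]
  refine mk_eq_of_equivalent (ExplicitFr.equivalent_of_surjective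
    (c := (ExplicitFr.ofHom f).push g) (a := .ofHom (f ≫ g)) (𝟙 (Aff 0 X.left))
    Function.surjective_id (Category.id_comp _) (fun i => i.elim0) ?_)
  simp [ExplicitFr.push, ExplicitFr.ofHom]

lemma comp_ofHom_sigma (f : X ⟶ Y) :
    comp (zero_add 1) (ofHom f) (sigma Y) = comp (add_zero 1) (sigma X) (ofHom f) := by
  rw [ofHom, sigma, sigma, comp_mk, comp_mk,
    mk_eq_of_equivalent (ExplicitFr.comp_ofHom _ f),
    mk_eq_of_equivalent (ExplicitFr.comp_ofHom_sigma f)]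

end ZF

/-! ### Pairs -/

/-- A pair `(X, V)`: a scheme `X` over `S` together with an open subset `V` of `X`. -/
structure Pair (S : Scheme.{u}) where
  X : Over S
  V : X.left.Opens

namespace Pair

variable {S : Scheme.{u}}

/-- The open subscheme `V` of the pair `(X, V)`. -/
def openPart (A : Pair S) : Over S := Over.mk (A.V.ι ≫ A.X.hom)

/-- The inclusion `V ⟶ X` of a pair `(X, V)`. -/
def incl (A : Pair S) : A.openPart ⟶ A.X := Over.homMk A.V.ι

/-- A morphism of pairs `(X, V) ⟶ (Y, W)`: a morphism `X ⟶ Y` sending `V` to `W`. -/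
structure Hom (A B : Pair S) where
  hom : A.X ⟶ B.X
  le : A.V ≤ hom.left ⁻¹ᵁ B.V

/-- The morphism `V ⟶ W` induced by a morphism of pairs `(X, V) ⟶ (Y, W)`. -/
def Hom.restrict {A B : Pair S} (f : Hom A B) : A.openPart ⟶ B.openPart :=
  Over.homMk (f.hom.left.resLE B.V A.V f.le) (by simp [openPart])

lemma Hom.restrict_incl {A B : Pair S} (f : Hom A B) :
    f.restrict ≫ B.incl = A.incl ≫ f.hom := by
  ext1
  exact Scheme.Hom.resLE_comp_ι _ _

/-- The pair `𝔸¹ × (X, V) = (𝔸¹_X, 𝔸¹_V)`. -/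
def affineLine (A : Pair S) : Pair S where
  X := Over.mk (Aff.pr 1 A.X.left ≫ A.X.hom)
  V := Aff.pr 1 A.X.left ⁻¹ᵁ A.V

/-- The section `(X, V) ⟶ 𝔸¹ × (X, V)` at a global function `c` of `X` (used for `c = 0, 1`). -/
def sectionAt (A : Pair S) (c : Γ(A.X.left, ⊤)) : Hom A A.affineLine where
  hom := Over.homMk (Aff.lift (𝟙 _) fun _ => c) (by simp [affineLine])
  le := by
    change A.V ≤ (Aff.lift (𝟙 _) fun _ => c) ⁻¹ᵁ Aff.pr 1 A.X.left ⁻¹ᵁ A.V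
    rw [← Scheme.Hom.comp_preimage, Aff.lift_pr]
    rfl

end Pair

/-- The group `ℤFₙᵖʳ((X, V), (Y, W))` of pairs `(a, b)` in `ℤFₙ(X, Y) ⊕ ℤFₙ(V, W)` whose
images in `ℤFₙ(V, Y)` agree. -/
def ZFpr {S : Scheme.{u}} (n : ℕ) (A B : Pair S) :
    AddSubgroup (ZF n A.X B.X × ZF n A.openPart B.openPart) :=
  AddMonoidHom.ker
    ((ZF.comp (zero_add n) (ZF.ofHom A.incl)).comp (AddMonoidHom.fst _ _) -
      ((ZF.comp (add_zero n)).flip (ZF.ofHom B.incl)).comp (AddMonoidHom.snd _ _))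

namespace ZFpr

variable {S : Scheme.{u}} {m n N : ℕ} {A B C : Pair S}

lemma mem_iff {x : ZF n A.X B.X × ZF n A.openPart B.openPart} :
    x ∈ ZFpr n A B ↔ ZF.comp (zero_add n) (ZF.ofHom A.incl) x.1 =
      ZF.comp (add_zero n) x.2 (ZF.ofHom B.incl) := by
  rw [ZFpr, AddMonoidHom.mem_ker, AddMonoidHom.sub_apply, sub_eq_zero]
  rfl

/-- Composition in `ℤF_*ᵖʳ` (in diagrammatic order). -/
def comp (h : m + n = N) (x : ZFpr m A B) (y : ZFpr n B C) : ZFpr N A C :=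
  ⟨(ZF.comp h x.1.1 y.1.1, ZF.comp h x.1.2 y.1.2), by
    rw [mem_iff, ← ZF.comp_assoc (zero_add m) h h (zero_add N), mem_iff.1 x.2,
      ZF.comp_assoc (add_zero m) h (zero_add n) h, mem_iff.1 y.2,
      ZF.comp_assoc h (add_zero N) (add_zero n) h]⟩

/-- The class `⟨⟨f⟩⟩` of a morphism of pairs. -/
def ofHom (f : Pair.Hom A B) : ZFpr 0 A B :=
  ⟨(ZF.ofHom f.hom, ZF.ofHom f.restrict), by
    rw [mem_iff, ZF.comp_ofHom_ofHom, ZF.comp_ofHom_ofHom, f.restrict_incl]⟩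

/-- The class `⟨⟨σ_X⟩⟩ = (⟨σ_X⟩, ⟨σ_V⟩)` for a pair `(X, V)`. -/
def sigma (A : Pair S) : ZFpr 1 A A :=
  ⟨(ZF.sigma A.X, ZF.sigma A.openPart), by rw [mem_iff, ZF.comp_ofHom_sigma]⟩

/-- The subgroup of the differences `i₀^* H - i₁^* H` for `H` in `ℤFₙᵖʳ(𝔸¹ × A, B)`; the quotient
by it is the Hom-group of the homotopy category of pairs. -/
def homotopySubgroup (n : ℕ) (A B : Pair S) : AddSubgroup (ZFpr n A B) :=
  AddSubgroup.closure {x | ∃ H : ZFpr n A.affineLine B,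
    x = comp (zero_add n) (ofHom (A.sectionAt 0)) H - comp (zero_add n) (ofHom (A.sectionAt 1)) H}

end ZFpr

/-- `X` is essentially smooth over `S`: it is a localization of a smooth separated scheme `Y` of
finite type over `S`, that is, there is a morphism `j : X ⟶ Y` over `S` which is a homeomorphism
onto its image and induces isomorphisms on local rings. Examples are all smooth separated schemes of
finite type, their open subschemes and their local schemes. -/
def IsEssentiallySmooth {S : Scheme.{u}} (X : Over S) : Prop :=
  ∃ (Y : Over S) (j : X ⟶ Y), Smooth Y.hom ∧ IsSeparated Y.hom ∧ QuasiCompact Y.hom ∧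
    Topology.IsEmbedding j.left ∧ ∀ x, IsIso (j.left.stalkMap x)

namespace ZFpr

variable {S : Scheme.{u}}

/-- The part of level `N` of the ideal generated by the identities of the pairs `(X, X)`: it is
generated by the composites through such pairs. -/
def idealSubgroup (N : ℕ) (A B : Pair S) : AddSubgroup (ZFpr N A B) :=
  AddSubgroup.closure {x | ∃ (m n : ℕ) (h : m + n = N) (X : Over S) (_ : IsEssentiallySmooth X)
    (a : ZFpr m A ⟨X, ⊤⟩) (b : ZFpr n ⟨X, ⊤⟩ B), x = comp h a b}

end ZFpr

/-- The Hom-group of level `n` of the category obtained from `ℤF_*ᵖʳ` by identifying homotopic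
morphisms and annihilating the identities of the pairs `(X, X)`. -/
abbrev ZFbar {S : Scheme.{u}} (n : ℕ) (A B : Pair S) : Type (u + 1) :=
  ZFpr n A B ⧸ (ZFpr.homotopySubgroup n A B ⊔ ZFpr.idealSubgroup n A B)

/-- The class of an element of `ℤFₙᵖʳ(A, B)` in `ZFbar n A B`. -/
def ZFpr.cls {S : Scheme.{u}} {n : ℕ} {A B : Pair S} (x : ZFpr n A B) : ZFbar n A B :=
  QuotientAddGroup.mk x

/-! ### The relative affine line over a local scheme -/

/-- The local scheme `Spec 𝒪_{X,x}` of `X` at `x`. -/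
def localScheme {S : Scheme.{u}} (X : Over S) (x : X.left) : Over S :=
  Over.mk (X.left.fromSpecStalk x ≫ X.hom)

/-- The pair `(𝔸¹_W, 𝔸¹_W - 0 × W)`. -/
def linePair {S : Scheme.{u}} (W : Over S) : Pair S where
  X := Over.mk (Aff.pr 1 W.left ≫ W.hom)
  V := (Aff 1 W.left).basicOpen (Aff.coord W.left 0)

/-- The pair `(U, U ∩ V)` for an open subset `U` of `X`, where `(X, V)` is a pair. -/
def Pair.restrict {S : Scheme.{u}} (A : Pair S) (U : A.X.left.Opens) : Pair S where
  X := Over.mk (U.ι ≫ A.X.hom)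
  V := U.ι ⁻¹ᵁ A.V

/-- The inclusion `(U, U ∩ V) ⟶ (X, V)`. -/
def Pair.restrictHom {S : Scheme.{u}} (A : Pair S) (U : A.X.left.Opens) :
    Pair.Hom (A.restrict U) A where
  hom := Over.homMk U.ι
  le := le_rfl

/-- The regular function on `𝔸¹_W`, for `W = Spec R`, given by a polynomial in `R[t]`. -/
def polyFun {R : CommRingCat.{u}} (f : Polynomial R) : Γ(Aff 1 (Spec R), ⊤) :=
  f.eval₂ ((Scheme.ΓSpecIso R).inv ≫ (Aff.pr 1 (Spec R)).appTop).hom (Aff.coord (Spec R) 0)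

/-- The open subscheme `(𝔸¹_W)_f` of `𝔸¹_W`, for `W = Spec 𝒪_{X,x}` and `f` in `𝒪_{X,x}[t]`. -/
def lineOpen {S : Scheme.{u}} (X : Over S) (x : X.left)
    (f : Polynomial (X.left.presheaf.stalk x)) : (linePair (localScheme X x)).X.left.Opens :=
  Scheme.basicOpen (Aff 1 (Spec (X.left.presheaf.stalk x))) (polyFun f)

end FramedCorr

end

open FramedCorr

/-! Write `t` for the coordinate of `𝔸¹_W` and `X` for the extra variable of a level-one
correspondence. A polynomial `h` in `X`, monic over the functions of the source, has a zero locus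
finite over the source. Framing it by `h` and sending it to the point with coordinate `X` gives a
correspondence to `𝔸¹_W`. If `h ≡ 1` modulo `F`, the support avoids `F = 0`, so the target is `V`.
If `h(0) = -t`, the support avoids `X = 0` over the locus where `t` is invertible, so it is a
correspondence of pairs. Since `F(0)` is a unit, with inverse `b`, the polynomial `h = X³ F + 1 - (1
+ t) b F` has all these properties. It serves as inverse of the inclusion on both sides, because
both composites are again given by `h`: with the target enlarged to `𝔸¹_W` in one case, with the
source restricted to `V` in the other.

Both identities are therefore instances of `IsLinePair.cls_toPr_eq_sigma`: on the locus where `e` is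
invertible (`e = 1` for `𝔸¹_W`, `e = F` for `V`), any such `h` of degree at least `deg e + 3`
represents `σ`. On this locus `e(t)` is a unit, and so is `e(0)`, so `e` is coprime to `X (X - t)`.
The Chinese remainder theorem gives a monic `p` of degree `deg h - 1` with `(X - t) p ≡ 1` modulo
`e` and `p ≡ 1` modulo `X (X - t)` (`exists_monic_congr`). The straight line from `h` to `(X - t) p`
stays monic, `≡ 1` modulo `e` and equal to `-t` at `0`, so it is a homotopy of pairs
(`cls_homotopy`).

The zero loci of `X - t` and `p` are disjoint, so the class is a sum of two. The part on `p = 0`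
never meets `X = 0`; it factors through a pair `(E, E)` with `E` essentially smooth and dies in the
quotient (`cls_eq_zero`). The part on the graph `X = t` has framing `(X - t) p`, and three
homotopies turn it into `σ`: `p` is deformed to `1` (`cls_rescale`), the target coordinate from `X`
to `t` (`cls_moveTarget`), and the support from `X = t` to `X = 0` (`cls_moveSupport`).

To keep schemes out of these arguments, correspondences are encoded by polynomial data `LineFr`. The
operations on framed correspondences that are needed (base change, change of target, disjoint sums)
are translated once and for all into operations on the data. -/

noncomputable section

namespace FramedCorr

open Polynomial

/-! ### Polynomial functions on the affine line -/

/-- The regular function on `𝔸¹_B` given by a polynomial with coefficients in `Γ(B, ⊤)`. -/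
def polyEval (B : Scheme.{u}) : Γ(B, ⊤)[X] →+* Γ(Aff 1 B, ⊤) :=
  eval₂RingHom (Aff.pr 1 B).appTop.hom (Aff.coord B 0)

lemma appTop_polyEval {T B : Scheme.{u}} (a : T ⟶ Aff 1 B) (p : Γ(B, ⊤)[X]) :
    a.appTop (polyEval B p) =
      p.eval₂ (a ≫ Aff.pr 1 B).appTop.hom (a.appTop (Aff.coord B 0)) := by
  change a.appTop.hom (p.eval₂ _ _) = _
  rw [hom_eval₂]
  rfl

lemma appTop_polyFun {R : CommRingCat.{u}} {T : Scheme.{u}} (a : T ⟶ Aff 1 (Spec R)) (p : R[X]) :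
    a.appTop (polyFun p) = p.eval₂ ((Scheme.ΓSpecIso R).inv ≫ (a ≫ Aff.pr 1 (Spec R)).appTop).hom
      (a.appTop (Aff.coord (Spec R) 0)) := by
  change a.appTop.hom (p.eval₂ _ _) = _
  rw [hom_eval₂]
  rfl

lemma polyFun_eq_polyEval {R : CommRingCat.{u}} (p : R[X]) :
    polyFun p = polyEval (Spec R) (p.map (Scheme.ΓSpecIso R).inv.hom) := by
  rw [polyEval, coe_eval₂RingHom, eval₂_map]
  rfl

/-- With `R = Γ(B, ⊤)`, the algebra `R[X]/(m)` is finite over `R` because `m` is monic. Its spectrum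
is a closed subscheme of `𝔸¹` over `Spec R`, and the base change along `B ⟶ Spec R`, with `B` not
necessarily affine, is a closed subscheme of `𝔸¹_B`, finite over `B`, whose image contains the zeros
of `m`. -/
lemma isFinite_of_monic {B : Scheme.{u}} {m : Γ(B, ⊤)[X]} (hm : m.Monic) (Z : Closeds (Aff 1 B))
    (hZ : (Z : Set (Aff 1 B)) ⊆ (Aff 1 B).zeroLocus {polyEval B m}) :
    IsFinite (redι Z ≫ Aff.pr 1 B) := by
  let Q : CommRingCat.{u} := .of (AdjoinRoot m)
  let ρ : Γ(B, ⊤) ⟶ Q := CommRingCat.ofHom (AdjoinRoot.of m)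
  let c : Spec Q ⟶ Aff 1 (Spec Γ(B, ⊤)) :=
    Aff.lift (Spec.map ρ) fun _ => (Scheme.ΓSpecIso Q).inv (AdjoinRoot.root m)
  have hcp : c ≫ Aff.pr 1 _ = Spec.map ρ := Aff.lift_pr _ _
  have hc : IsClosedImmersion c := by
    have : IsAffine (Aff 1 (Spec Γ(B, ⊤))) :=
      inferInstanceAs (IsAffine (AffineSpace _ (Spec Γ(B, ⊤))))
    refine IsClosedImmersion.of_surjective_of_isAffine c fun q => ?_
    obtain ⟨q, rfl⟩ := (ConcreteCategory.bijective_of_isIso (Scheme.ΓSpecIso Q).inv).2 q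
    obtain ⟨p, rfl⟩ := AdjoinRoot.mk_surjective q
    refine ⟨polyFun p, ?_⟩
    rw [appTop_polyFun, hcp]
    have h1 : (Scheme.ΓSpecIso Γ(B, ⊤)).inv ≫ (Spec.map ρ).appTop = ρ ≫ (Scheme.ΓSpecIso Q).inv :=
      (Scheme.ΓSpecIso_inv_naturality ρ).symm
    rw [h1, Aff.lift_coord]
    change _ = (Scheme.ΓSpecIso Q).inv.hom _
    rw [← AdjoinRoot.aeval_eq, aeval_def, hom_eval₂]
    rfl
  have hf : IsFinite (Spec.map ρ) := by
    rw [IsFinite.SpecMap_iff]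
    have := hm.finite_adjoinRoot
    exact (RingHom.finite_algebraMap (A := Γ(B, ⊤)) (B := AdjoinRoot m)).2 this
  let a : Aff 1 B ⟶ Aff 1 (Spec Γ(B, ⊤)) := AffineSpace.map _ B.toSpecΓ
  have ha : IsPullback a (Aff.pr 1 B) (Aff.pr 1 _) B.toSpecΓ := AffineSpace.isPullback_map _
  have h2 := (IsPullback.of_hasPullback a c).flip.paste_vert ha
  have hfin : IsFinite (pullback.fst a c ≫ Aff.pr 1 B) := by
    refine (inferInstance : MorphismProperty.IsStableUnderBaseChange @IsFinite).of_isPullback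
      h2 ?_
    rwa [hcp]
  have hr : (Z : Set (Aff 1 B)) ⊆ Set.range (pullback.fst a c) := by
    refine hZ.trans fun w hw => ?_
    -- Membership in the image is tested at the residue field of `w`. All that matters about it is
    -- that it is nonempty and reduced: then `m`, which has empty nonvanishing locus there, is zero,
    -- and the coordinate defines a map out of `AdjoinRoot m`.
    obtain ⟨K, e, ⟨y⟩, hK, he⟩ : ∃ (K : Scheme.{u}) (e : K ⟶ Aff 1 B), Nonempty K ∧
        AlgebraicGeometry.IsReduced K ∧ ∀ y, e y = w :=
      ⟨_, (Aff 1 B).fromSpecResidueField w, inferInstance, inferInstance, by simp⟩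
    have h0 : e.appTop (polyEval B m) = 0 := by
      rw [← basicOpen_eq_bot_iff, ← Scheme.preimage_basicOpen_top]
      rw [Scheme.mem_zeroLocus_iff] at hw
      refine le_bot_iff.1 fun y hy => ?_
      exact (hw _ rfl (he y ▸ hy)).elim
    rw [appTop_polyEval] at h0
    let φ : Q ⟶ Γ(K, ⊤) := CommRingCat.ofHom (AdjoinRoot.lift _ _ h0)
    let v : K ⟶ Spec Q := Scheme.toSpecΓ _ ≫ Spec.map φ
    have hρφ : ρ ≫ φ = (e ≫ Aff.pr 1 B).appTop := by
      ext x
      exact AdjoinRoot.lift_of h0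
    have hv : e ≫ a = v ≫ c := by
      refine Aff.hom_ext ?_ fun i => ?_
      · rw [Category.assoc, Category.assoc, ha.w, hcp, Category.assoc, ← Spec.map_comp, hρφ,
          ← Category.assoc, Scheme.toSpecΓ_naturality]
      · rw [Aff.comp_appTop, Aff.comp_appTop, Aff.lift_coord]
        have h3 : a.appTop (Aff.coord _ i) = Aff.coord B i := AffineSpace.map_appTop_coord _ _
        have h4 : (Scheme.ΓSpecIso Q).inv ≫ v.appTop = φ := by
          rw [Scheme.Hom.comp_appTop, ← Category.assoc, ← Scheme.ΓSpecIso_inv_naturality,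
            Category.assoc, Scheme.toSpecΓ_appTop, Iso.inv_hom_id, Category.comp_id]
        have h5 := congrArg (fun g => g.hom (AdjoinRoot.root m)) h4
        refine Eq.trans ?_ h5.symm
        rw [h3]
        obtain rfl : i = 0 := Subsingleton.elim _ _
        exact (AdjoinRoot.lift_root h0).symm
    refine ⟨pullback.lift e v hv y, ?_⟩
    rw [← Scheme.Hom.comp_apply, pullback.lift_fst]
    exact he y
  obtain ⟨l, hl, hl'⟩ := exists_redι_fac (pullback.fst a c) Z hr
  rw [← hl, Category.assoc]
  infer_instance

/-! ### Restrictions and equivalence -/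

/-- The base change of the open immersion to `Z` is an open immersion that is surjective, hence an
isomorphism. -/
lemma isEtaleNbhd_ι {B : Scheme.{u}} {Z : Closeds B} {U : B.Opens} (h : (Z : Set B) ⊆ U) :
    IsEtaleNbhd U.ι Z := by
  refine ⟨inferInstance, ?_⟩
  have : Surjective (pullback.snd U.ι (redι Z)) := by
    rw [surjective_iff, ← Set.range_eq_univ, Scheme.Pullback.range_snd, Set.preimage_eq_univ_iff,
      range_redι]
    simpa using h
  exact (isIso_iff_isOpenImmersion_and_surjective _).2 ⟨inferInstance, this⟩

namespace ExplicitFr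

variable {S : Scheme.{u}} {n : ℕ} {X Y : Over S}

lemma mem_Z_iff (a : ExplicitFr n X Y) (x : a.U) :
    a.p x ∈ a.Z ↔ x ∈ a.U.zeroLocus (Set.range a.φ) := by
  rw [a.zeroLocus_φ]
  rfl

/-- The framing determines the support: the zero locus of the pulled-back functions is the preimage
of that of the original ones. Hence equality of supports need not be assumed, only that the smaller
neighbourhood covers the support of `a`. -/
lemma equivalent_of_restricts {c a : ExplicitFr n X Y} (h : c.Restricts a)
    (hr : (a.Z : Set (Aff n X.left)) ⊆ Set.range c.p) : c.Equivalent a := by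
  obtain ⟨j, hp, hφ, hg⟩ := h
  have key (x : c.U) : c.p x ∈ c.Z ↔ c.p x ∈ a.Z := by
    have h1 : c.φ = fun i => j.appTop (a.φ i) := funext fun i => (hφ i).symm
    rw [mem_Z_iff, ← hp, Scheme.Hom.comp_apply, mem_Z_iff, h1, zeroLocus_appTop]
    rfl
  refine ⟨c, rfl, SetLike.ext fun w => ?_, ⟨𝟙 _, by simp, by simp, by simp⟩, ⟨j, hp, hφ, hg⟩⟩
  constructor
  · intro hw
    obtain ⟨x, rfl⟩ := c.nbhd.exists_preimage hw
    exact (key x).1 hw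
  · intro hw
    obtain ⟨x, rfl⟩ := hr hw
    exact (key x).2 hw

end ExplicitFr

/-! ### Framed correspondences on the affine line given by polynomials -/

/-- The morphism `𝔸¹_B ⟶ 𝔸¹_B'` induced by `B ⟶ B'`. -/
def Aff.map {B B' : Scheme.{u}} (f : B ⟶ B') : Aff 1 B ⟶ Aff 1 B' :=
  Aff.lift (Aff.pr 1 B ≫ f) (Aff.coord B)

lemma Aff.map_pr {B B' : Scheme.{u}} (f : B ⟶ B') :
    Aff.map f ≫ Aff.pr 1 B' = Aff.pr 1 B ≫ f :=
  Aff.lift_pr _ _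

lemma Aff.map_coord {B B' : Scheme.{u}} (f : B ⟶ B') (i : Fin 1) :
    (Aff.map f).appTop (Aff.coord B' i) = Aff.coord B i :=
  Aff.lift_coord _ _ _

lemma Aff.map_polyEval {B B' : Scheme.{u}} (f : B ⟶ B') (p : Γ(B', ⊤)[X]) :
    (Aff.map f).appTop (polyEval B' p) = polyEval B (p.map f.appTop.hom) := by
  rw [appTop_polyEval, Aff.map_pr, Aff.map_coord, polyEval, coe_eval₂RingHom, eval₂_map]
  rfl

/-- The morphism `τ` identifies `T` with the open subscheme of `𝔸¹_W` where the polynomial `e` is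
invertible. -/
structure IsLineOpen {S : Scheme.{u}} {W T : Over S} (τ : T.left ⟶ Aff 1 W.left)
    (e : Γ(W.left, ⊤)[X]) : Prop where
  w : τ ≫ Aff.pr 1 W.left ≫ W.hom = T.hom
  isOpenImmersion : IsOpenImmersion τ
  opensRange_eq : τ.opensRange = (Aff 1 W.left).basicOpen (polyEval _ e)

/-- Polynomial data for a framed correspondence of level `1` to the locus in `𝔸¹` where `e` is
invertible: its support is the zero locus of `ψ`, its étale neighbourhood is the locus where `u` is
invertible, the framing function is `ψ * w`, and the morphism to the target has coordinate `y`. -/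
structure LineFr {R Λ : Type u} [CommRing R] [CommRing Λ] (ρ : R →+* Λ) (e : R[X]) where
  (ψ w u y : Λ[X])
  -- The first condition makes the support finite over the base. The two divisibilities ensure that
  -- where `u` is invertible, `ψ * w` has the same zeros as `ψ` and the target lies in the locus
  -- where `e` is invertible. Coprimality places the zeros of `ψ` inside the locus where `u` is
  -- invertible.
  dvd_monic : ∃ m : Λ[X], m.Monic ∧ ψ ∣ m
  w_dvd : w ∣ u
  e_dvd : e.eval₂ (C.comp ρ) y ∣ u
  coprime : IsCoprime ψ u

lemma basicOpen_le_of_dvd {X : Scheme.{u}} {a b : Γ(X, ⊤)} (h : a ∣ b) :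
    X.basicOpen b ≤ X.basicOpen a := by
  obtain ⟨c, rfl⟩ := h
  rw [Scheme.basicOpen_mul]
  exact inf_le_left

lemma zeroLocus_subset_basicOpen {X : Scheme.{u}} {a b : Γ(X, ⊤)} (h : IsCoprime a b) :
    X.zeroLocus {a} ⊆ X.basicOpen b := by
  intro x hx
  rw [Scheme.mem_zeroLocus_iff] at hx
  have hx := hx a rfl
  obtain ⟨r, s, h⟩ := h
  have h1 := X.basicOpen_add_le (r * a) (s * b)
  rw [h, Scheme.basicOpen_one] at h1
  rcases h1 (Opens.mem_top x) with h2 | h2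
  · exact (hx (basicOpen_le_of_dvd (Dvd.intro_left r rfl) h2)).elim
  · exact basicOpen_le_of_dvd (Dvd.intro_left s rfl) h2

lemma zeroLocus_subset_of_dvd {X : Scheme.{u}} {a b : Γ(X, ⊤)} (h : a ∣ b) :
    X.zeroLocus {a} ⊆ X.zeroLocus {b} := by
  intro x hx
  rw [Scheme.mem_zeroLocus_iff] at hx ⊢
  rintro _ rfl h1
  exact hx _ rfl (basicOpen_le_of_dvd h h1)

namespace LineFr

variable {S : Scheme.{u}} {W B T : Over S} {τ : T.left ⟶ Aff 1 W.left} {e : Γ(W.left, ⊤)[X]}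

/-- The étale neighbourhood of the framed correspondence given by polynomial data. -/
abbrev nbhd {R : Type u} [CommRing R] {B : Scheme.{u}} {ρ : R →+* Γ(B, ⊤)} {e : R[X]}
    (D : LineFr ρ e) : (Aff 1 B).Opens :=
  (Aff 1 B).basicOpen (polyEval _ D.u)

/-- The morphism to `𝔸¹_W` of the framed correspondence given by polynomial data. -/
def toLine {β : B ⟶ W} (D : LineFr β.left.appTop.hom e) : D.nbhd.toScheme ⟶ Aff 1 W.left :=
  D.nbhd.ι ≫ Aff.lift (Aff.pr 1 B.left ≫ β.left) fun _ => polyEval _ D.y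

lemma appTop_lift_polyEval (β : B.left ⟶ W.left) (y : Γ(B.left, ⊤)[X]) :
    (Aff.lift (n := 1) (Aff.pr 1 B.left ≫ β) fun _ => polyEval _ y).appTop (polyEval _ e) =
      polyEval _ (e.eval₂ (C.comp β.appTop.hom) y) := by
  rw [appTop_polyEval, Aff.lift_pr, Aff.lift_coord, hom_eval₂]
  congr 1
  ext r
  change _ = eval₂ _ _ (C _)
  rw [eval₂_C]
  rfl

lemma range_toLine {β : B ⟶ W} (D : LineFr β.left.appTop.hom e) (hτ : IsLineOpen τ e) :
    Set.range D.toLine ⊆ Set.range τ := by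
  have := hτ.isOpenImmersion
  rw [← Scheme.Hom.coe_opensRange τ, hτ.opensRange_eq]
  rintro _ ⟨x, rfl⟩
  change x ∈ D.toLine ⁻¹ᵁ (Aff 1 W.left).basicOpen (polyEval W.left e)
  rw [toLine, Scheme.Hom.comp_preimage, Scheme.preimage_basicOpen_top, appTop_lift_polyEval]
  exact basicOpen_le_of_dvd (map_dvd _ D.e_dvd) x.2

/-- The framed correspondence given by polynomial data. -/
def toFr {β : B ⟶ W} (D : LineFr β.left.appTop.hom e) (hτ : IsLineOpen τ e) :
    ExplicitFr 1 B T where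
  Z := ⟨(Aff 1 B.left).zeroLocus {polyEval _ D.ψ}, Scheme.zeroLocus_isClosed _ _⟩
  finite := by
    obtain ⟨m, hm, hd⟩ := D.dvd_monic
    exact isFinite_of_monic hm _ (zeroLocus_subset_of_dvd (map_dvd _ hd))
  U := D.nbhd.toScheme
  p := D.nbhd.ι
  nbhd := isEtaleNbhd_ι (zeroLocus_subset_basicOpen (D.coprime.map _))
  φ := fun _ => D.nbhd.ι.appTop (polyEval _ (D.ψ * D.w))
  zeroLocus_φ := by
    rw [ExplicitFr.zeroLocus_appTop (n := 1), Set.range_const]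
    ext x
    have h1 := basicOpen_le_of_dvd (map_dvd (polyEval _) D.w_dvd) x.2
    simp only [Set.mem_preimage, Scheme.mem_zeroLocus_iff, Set.mem_singleton_iff, forall_eq,
      map_mul, Scheme.basicOpen_mul, Closeds.coe_mk]
    exact not_congr ⟨fun h => h.1, fun h => ⟨h, h1⟩⟩
  g :=
    have := hτ.isOpenImmersion
    IsOpenImmersion.lift τ D.toLine (D.range_toLine hτ)
  g_over := by
    rw [← hτ.w, IsOpenImmersion.lift_fac_assoc, toLine, Category.assoc, Aff.lift_pr_assoc]
    simp

end LineFr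

namespace ExplicitFr

variable {S : Scheme.{u}} {B B' T : Over S}

/-- Recognizes a precomposition with a morphism without computing its fibre product. The support of
the composite lies over that of `a'`, so a map of neighbourhoods compatible with the data suffices
once `a.p` covers the preimage of the support of `a'`. -/
lemma equivalent_ofHom_comp (f : B ⟶ B') {a : ExplicitFr 1 B T} {a' : ExplicitFr 1 B' T}
    (k : a.U ⟶ a'.U) (hp : k ≫ a'.p = a.p ≫ Aff.map f.left)
    (hφ : ∀ i, k.appTop (a'.φ i) = a.φ i) (hg : k ≫ a'.g = a.g)
    (hr : Aff.map f.left ⁻¹' (a'.Z : Set (Aff 1 B'.left)) ⊆ Set.range a.p) :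
    a.Equivalent (comp (zero_add 1) (ofHom f) a') := by
  let s : B.left ⟶ Aff 0 B.left := inv (Aff.pr 0 B.left)
  have hs : s ≫ Aff.pr 0 B.left = 𝟙 _ := IsIso.inv_hom_id _
  let F₁ : compU (ofHom f) a' ⟶ Aff 0 B.left := pullback.fst _ _
  let F₂ : compU (ofHom f) a' ⟶ a'.U := pullback.snd _ _
  have w : F₁ ≫ Aff.pr 0 B.left ≫ f.left = F₂ ≫ a'.p ≫ Aff.pr 1 B'.left := pullback.condition
  let K : a.U ⟶ compU (ofHom f) a' :=
    pullback.lift (a.p ≫ Aff.pr 1 B.left ≫ s) k (by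
      rw [reassoc_of% hp, Aff.map_pr]
      change (_ ≫ _ ≫ _) ≫ Aff.pr 0 B.left ≫ f.left = _
      rw [Category.assoc, Category.assoc, reassoc_of% hs])
  have K₁ : K ≫ F₁ = a.p ≫ Aff.pr 1 B.left ≫ s := pullback.lift_fst _ _ _
  have K₂ : K ≫ F₂ = k := pullback.lift_snd _ _ _
  refine equivalent_of_restricts ⟨K, ?_, fun i => ?_, ?_⟩ ?_
  · change K ≫ Aff.pair (zero_add 1) (F₁ ≫ 𝟙 _) (F₂ ≫ a'.p) = _
    rw [Aff.comp_pair]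
    refine Aff.hom_ext ?_ fun i => ?_
    · rw [Aff.pair_pr, Category.comp_id, K₁, Category.assoc, Category.assoc, hs, Category.comp_id]
    · rw [Aff.pair_coord, zero_append, reassoc_of% K₂, hp, Aff.comp_appTop, Aff.map_coord]
  · change K.appTop (append (zero_add 1) (fun i => F₁.appTop ((ofHom f).φ i))
      (fun i => F₂.appTop (a'.φ i)) i) = _
    rw [zero_append, ← Aff.comp_appTop, K₂, hφ]
  · change K ≫ F₂ ≫ a'.g = _
    rw [reassoc_of% K₂, hg]
  · refine Set.Subset.trans ?_ hr
    rintro _ ⟨x, ⟨-, hx⟩, rfl⟩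
    have h4 : compP (zero_add 1) (ofHom f) a' ≫ Aff.map f.left = F₂ ≫ a'.p := by
      change Aff.pair (zero_add 1) (F₁ ≫ 𝟙 _) (F₂ ≫ a'.p) ≫ _ = _
      refine Aff.hom_ext ?_ fun i => ?_
      · rw [Category.assoc, Aff.map_pr, Aff.pair_pr_assoc, Category.comp_id, w, Category.assoc]
      · rw [Aff.comp_appTop, Aff.map_coord, Aff.pair_coord, zero_append]
    change Aff.map f.left (compP (zero_add 1) (ofHom f) a' x) ∈ a'.Z
    rw [← Scheme.Hom.comp_apply, h4]
    exact hx

end ExplicitFr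

namespace LineFr

variable {S : Scheme.{u}} {W B B' T T' : Over S} {τ : T.left ⟶ Aff 1 W.left}
  {τ' : T'.left ⟶ Aff 1 W.left} {e e' : Γ(W.left, ⊤)[X]} {β : B ⟶ W} {β' : B' ⟶ W}

lemma g_comp (D : LineFr β.left.appTop.hom e) (hτ : IsLineOpen τ e) :
    (D.toFr hτ).g ≫ τ = D.toLine :=
  have := hτ.isOpenImmersion
  IsOpenImmersion.lift_fac _ _ _

/-- The common source of the comparison maps for shrinking neighbourhoods, changing the source along
`f` and changing the target along `j`. The framing enters only through the product `ψ * w`, so a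
factor may move between `ψ` and `w`. Maps to the target are compared after composition with the
monomorphism `τ`. -/
lemma exists_nbhd_hom (D : LineFr β.left.appTop.hom e) (hτ : IsLineOpen τ e)
    (D' : LineFr β'.left.appTop.hom e') (hτ' : IsLineOpen τ' e') (f : B ⟶ B') (hf : f ≫ β' = β)
    (j : T' ⟶ T) (hj : j.left ≫ τ = τ')
    (hu : D'.u.map f.left.appTop.hom ∣ D.u)
    (hφ : (D'.ψ * D'.w).map f.left.appTop.hom = D.ψ * D.w)
    (hy : D'.y.map f.left.appTop.hom = D.y) :
    ∃ k : (D.toFr hτ).U ⟶ (D'.toFr hτ').U,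
      k ≫ (D'.toFr hτ').p = (D.toFr hτ).p ≫ Aff.map f.left ∧
      (∀ i, k.appTop ((D'.toFr hτ').φ i) = (D.toFr hτ).φ i) ∧
      k ≫ (D'.toFr hτ').g ≫ j.left = (D.toFr hτ).g := by
  have hr : Set.range (D.nbhd.ι ≫ Aff.map f.left) ⊆ Set.range D'.nbhd.ι := by
    rw [Scheme.Opens.range_ι]
    rintro _ ⟨x, rfl⟩
    change x ∈ (D.nbhd.ι ≫ Aff.map f.left) ⁻¹ᵁ (Aff 1 B'.left).basicOpen (polyEval _ D'.u)
    rw [Scheme.Hom.comp_preimage, Scheme.preimage_basicOpen_top, Aff.map_polyEval]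
    exact basicOpen_le_of_dvd (map_dvd _ hu) x.2
  obtain ⟨k, hk⟩ : ∃ k : (D.toFr hτ).U ⟶ (D'.toFr hτ').U,
      k ≫ (D'.toFr hτ').p = (D.toFr hτ).p ≫ Aff.map f.left :=
    ⟨(IsOpenImmersion.lift D'.nbhd.ι _ hr : D.nbhd.toScheme ⟶ D'.nbhd.toScheme),
      IsOpenImmersion.lift_fac D'.nbhd.ι _ hr⟩
  refine ⟨k, hk, fun i => ?_, ?_⟩
  · change k.appTop ((D'.toFr hτ').p.appTop _) = (D.toFr hτ).p.appTop _
    rw [← Aff.comp_appTop, hk, Aff.comp_appTop, Aff.map_polyEval, hφ]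
  · have := hτ.isOpenImmersion
    rw [← cancel_mono τ, g_comp, Category.assoc, Category.assoc, hj, g_comp]
    change k ≫ (D'.toFr hτ').p ≫ _ = (D.toFr hτ).p ≫ _
    rw [reassoc_of% hk]
    congr 1
    refine Aff.hom_ext ?_ fun i => ?_
    · rw [Category.assoc, Aff.lift_pr, Aff.lift_pr, ← Category.assoc, Aff.map_pr, Category.assoc,
        ← hf, Over.comp_left]
    · rw [Aff.comp_appTop, Aff.lift_coord, Aff.lift_coord, Aff.map_polyEval, hy]

lemma map_id_appTop {X : Scheme.{u}} (p : Γ(X, ⊤)[X]) :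
    p.map (𝟙 X : X ⟶ X).appTop.hom = p := by
  rw [Scheme.Hom.id_appTop]
  exact Polynomial.map_id

lemma Aff_map_id (X : Scheme.{u}) : Aff.map (𝟙 X) = 𝟙 _ :=
  Aff.hom_ext (by rw [Aff.map_pr]; simp) fun i => by rw [Aff.map_coord]; simp

lemma restricts (D D' : LineFr β.left.appTop.hom e) (hτ : IsLineOpen τ e) (hu : D'.u ∣ D.u)
    (hφ : D'.ψ * D'.w = D.ψ * D.w) (hy : D'.y = D.y) : (D.toFr hτ).Restricts (D'.toFr hτ) := by
  obtain ⟨k, h1, h2, h3⟩ := exists_nbhd_hom D hτ D' hτ (𝟙 B) (by simp) (𝟙 T) (by simp)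
    (by rw [Over.id_left, map_id_appTop]; exact hu) (by rw [Over.id_left, map_id_appTop, hφ])
    (by rw [Over.id_left, map_id_appTop, hy])
  refine ⟨k, ?_, h2, ?_⟩
  · rw [h1, Over.id_left, Aff_map_id, Category.comp_id]
  · rw [← h3, Over.id_left, Category.comp_id]

/-- The class in `ℤF₁` of the framed correspondence given by polynomial data. -/
def toZF (D : LineFr β.left.appTop.hom e) (hτ : IsLineOpen τ e) : ZF 1 B T := ZF.mk (D.toFr hτ)

/-- Shrinking the étale neighbourhood. -/
def shrink {R Λ : Type u} [CommRing R] [CommRing Λ] {ρ : R →+* Λ} {e : R[X]} (D : LineFr ρ e)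
    (v : Λ[X]) (hv : IsCoprime D.ψ v) : LineFr ρ e where
  ψ := D.ψ
  w := D.w
  u := D.u * v
  y := D.y
  dvd_monic := D.dvd_monic
  w_dvd := D.w_dvd.mul_right v
  e_dvd := D.e_dvd.mul_right v
  coprime := D.coprime.mul_right hv

/-- The choice of `u` is immaterial: both correspondences restrict to the locus where both choices
are invertible, which still contains the support. -/
lemma toZF_congr (D D' : LineFr β.left.appTop.hom e) (hτ : IsLineOpen τ e) (hψ : D.ψ = D'.ψ)
    (hw : D.w = D'.w) (hy : D.y = D'.y) : D.toZF hτ = D'.toZF hτ := by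
  have hc : IsCoprime D.ψ D'.u := hψ ▸ D'.coprime
  have h (D'' : LineFr β.left.appTop.hom e) (hψ : D.ψ = D''.ψ) (hw : D.w = D''.w)
      (hy : D.y = D''.y) (hu : D''.u ∣ D.u * D'.u) :
      (D.shrink D'.u hc).toZF hτ = D''.toZF hτ := by
    refine ZF.mk_eq_of_equivalent (ExplicitFr.equivalent_of_restricts
      (restricts (D.shrink D'.u hc) D'' hτ hu ?_ hy.symm) ?_)
    · change _ = D.ψ * D.w
      rw [hψ, hw]
    · change _ ⊆ Set.range (D.shrink D'.u hc).nbhd.ι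
      rw [Scheme.Opens.range_ι]
      refine zeroLocus_subset_basicOpen (IsCoprime.map ?_ _)
      rw [← hψ]
      exact (D.shrink D'.u hc).coprime
  rw [← h D rfl rfl rfl (dvd_mul_right _ _), h D' hψ hw hy (dvd_mul_left _ _)]

/-- Near the zeros of one of two coprime factors the other factor is a unit, so it is absorbed into
`w`; the framing function itself does not change. -/
lemma toZF_eq_add (D D₁ D₂ : LineFr β.left.appTop.hom e) (hτ : IsLineOpen τ e)
    (hψ : D.ψ = D₁.ψ * D₂.ψ) (hw₁ : D₁.w = D₂.ψ * D.w) (hw₂ : D₂.w = D₁.ψ * D.w)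
    (hy₁ : D₁.y = D.y) (hy₂ : D₂.y = D.y) (hc : IsCoprime D₁.ψ D₂.ψ) :
    D.toZF hτ = D₁.toZF hτ + D₂.toZF hτ := by
  have h₁ : IsCoprime D₁.ψ D.u := (hψ ▸ D.coprime).of_mul_left_left
  have h₂ : IsCoprime D₂.ψ D.u := (hψ ▸ D.coprime).of_mul_left_right
  -- The neighbourhoods of the summands must map to that of `D`, so they are shrunk to the locus
  -- where `D.u` is invertible.
  rw [toZF_congr D₁ (D₁.shrink D.u h₁) hτ rfl rfl rfl,
    toZF_congr D₂ (D₂.shrink D.u h₂) hτ rfl rfl rfl]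
  refine ZF.mk_eq_add ⟨SetLike.coe_injective ?_, ?_, ?_, ?_⟩
  · change (Aff 1 B.left).zeroLocus {polyEval _ D.ψ} = (Aff 1 B.left).zeroLocus {polyEval _ D₁.ψ} ∪
      (Aff 1 B.left).zeroLocus {polyEval _ D₂.ψ}
    ext x
    simp only [Scheme.mem_zeroLocus_iff, Set.mem_union, Set.mem_singleton_iff, forall_eq, hψ,
      map_mul, Scheme.basicOpen_mul]
    change ¬ (_ ∧ _) ↔ _
    tauto
  · change Disjoint ((Aff 1 B.left).zeroLocus {polyEval _ D₁.ψ})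
      ((Aff 1 B.left).zeroLocus {polyEval _ D₂.ψ})
    rw [Set.disjoint_left]
    intro x hx hx'
    rw [Scheme.mem_zeroLocus_iff] at hx'
    exact hx' _ rfl (zeroLocus_subset_basicOpen (hc.map _) hx)
  · refine restricts _ D hτ (dvd_mul_left _ _) ?_ hy₁.symm
    change _ = D₁.ψ * D₁.w
    rw [hψ, hw₁, mul_assoc]
  · refine restricts _ D hτ (dvd_mul_left _ _) ?_ hy₂.symm
    change _ = D₂.ψ * D₂.w
    rw [hψ, hw₂]
    ring

lemma toZF_comp_ofHom (D : LineFr β.left.appTop.hom e) (hτ : IsLineOpen τ e)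
    (D' : LineFr β.left.appTop.hom e') (hτ' : IsLineOpen τ' e') (j : T' ⟶ T)
    (hj : j.left ≫ τ = τ') (hψ : D'.ψ = D.ψ) (hw : D'.w = D.w) (hy : D'.y = D.y) :
    ZF.comp (add_zero 1) (D'.toZF hτ') (ZF.ofHom j) = D.toZF hτ := by
  have hc : IsCoprime D.ψ D'.u := hψ ▸ D'.coprime
  rw [toZF_congr D (D.shrink D'.u hc) hτ rfl rfl rfl, toZF, toZF, ZF.ofHom, ZF.comp_mk,
    ZF.mk_eq_of_equivalent (ExplicitFr.comp_ofHom _ j)]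
  refine (ZF.mk_eq_of_equivalent (ExplicitFr.equivalent_of_restricts ?_ ?_)).symm
  · obtain ⟨k, h1, h2, h3⟩ := exists_nbhd_hom (D.shrink D'.u hc) hτ D' hτ' (𝟙 B) (by simp) j hj
      (by rw [Over.id_left, map_id_appTop]; exact dvd_mul_left _ _)
      (by rw [Over.id_left, map_id_appTop, hψ, hw]; rfl)
      (by rw [Over.id_left, map_id_appTop, hy]; rfl)
    refine ⟨k, ?_, h2, h3⟩
    exact h1.trans (by rw [Over.id_left, Aff_map_id, Category.comp_id])
  · change (Aff 1 B.left).zeroLocus {polyEval _ D'.ψ} ⊆ Set.range (D.shrink D'.u hc).nbhd.ι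
    rw [Scheme.Opens.range_ι, hψ]
    exact zeroLocus_subset_basicOpen ((D.shrink D'.u hc).coprime.map _)

/-- Base change of polynomial data. -/
def map {R Λ Λ' : Type u} [CommRing R] [CommRing Λ] [CommRing Λ'] {ρ : R →+* Λ} {e : R[X]}
    (D : LineFr ρ e) (θ : Λ →+* Λ') {ρ' : R →+* Λ'} (h : θ.comp ρ = ρ') : LineFr ρ' e where
  ψ := D.ψ.map θ
  w := D.w.map θ
  u := D.u.map θ
  y := D.y.map θ
  dvd_monic := by
    obtain ⟨m, hm, hd⟩ := D.dvd_monic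
    exact ⟨m.map θ, hm.map θ, Polynomial.map_dvd θ hd⟩
  w_dvd := Polynomial.map_dvd θ D.w_dvd
  e_dvd := by
    have := Polynomial.map_dvd θ D.e_dvd
    rw [← coe_mapRingHom, hom_eval₂, coe_mapRingHom] at this
    convert this using 2
    ext
    simp [← h]
  coprime := by
    simpa using D.coprime.map (mapRingHom θ)

/-- Precomposition with `f` is base change of the coefficients. Nothing is asked of the two
polynomials `u`, since `D` may be shrunk to the preimage of the neighbourhood of `D'`. -/
lemma ofHom_comp_toZF (D' : LineFr β'.left.appTop.hom e) (D : LineFr β.left.appTop.hom e)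
    (hτ : IsLineOpen τ e) (f : B ⟶ B') (hf : f ≫ β' = β)
    (hψ : D'.ψ.map f.left.appTop.hom = D.ψ) (hw : D'.w.map f.left.appTop.hom = D.w)
    (hy : D'.y.map f.left.appTop.hom = D.y) :
    ZF.comp (zero_add 1) (ZF.ofHom f) (D'.toZF hτ) = D.toZF hτ := by
  have hc : IsCoprime D.ψ (D'.u.map f.left.appTop.hom) := by
    have := D'.coprime.map (mapRingHom f.left.appTop.hom)
    rwa [coe_mapRingHom, hψ] at this
  rw [toZF_congr D (D.shrink _ hc) hτ rfl rfl rfl, toZF, toZF, ZF.ofHom, ZF.comp_mk]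
  obtain ⟨k, h1, h2, h3⟩ := exists_nbhd_hom (D.shrink _ hc) hτ D' hτ f hf (𝟙 T) (by simp)
    (dvd_mul_left _ _) (by rw [Polynomial.map_mul, hψ, hw]; rfl) hy
  rw [Over.id_left, Category.comp_id] at h3
  refine (ZF.mk_eq_of_equivalent (ExplicitFr.equivalent_ofHom_comp f k h1 h2 h3 ?_)).symm
  change _ ⊆ Set.range (D.shrink _ hc).nbhd.ι
  rw [Scheme.Opens.range_ι]
  refine Set.Subset.trans ?_ (zeroLocus_subset_basicOpen ((D.shrink _ hc).coprime.map _))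
  intro x hx
  change Aff.map f.left x ∈ (Aff 1 B'.left).zeroLocus {polyEval _ D'.ψ} at hx
  change _ ∈ (Aff 1 B.left).zeroLocus {polyEval _ D.ψ}
  rw [Scheme.mem_zeroLocus_iff] at hx ⊢
  rintro _ rfl h7
  refine hx _ rfl ?_
  rw [← hψ, ← Aff.map_polyEval, ← Scheme.preimage_basicOpen_top] at h7
  exact h7

end LineFr

/-! ### Coordinates on open subschemes of the affine line, and the class of `σ`. -/

lemma polyEval_X (B : Scheme.{u}) : polyEval B X = Aff.coord B 0 :=
  eval₂_X _ _

lemma polyEval_C (B : Scheme.{u}) (r : Γ(B, ⊤)) :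
    polyEval B (C r) = (Aff.pr 1 B).appTop r :=
  eval₂_C _ _

lemma isUnit_of_basicOpen_eq_top {X : Scheme.{u}} {r : Γ(X, ⊤)} (h : X.basicOpen r = ⊤) :
    IsUnit r :=
  RingedSpace.isUnit_of_isUnit_germ X.toRingedSpace ⊤ r fun x hx =>
    (X.mem_basicOpen r x hx).1 (by rw [h]; exact hx)

namespace IsLineOpen

variable {S : Scheme.{u}} {W T : Over S} {τ : T.left ⟶ Aff 1 W.left} {e : Γ(W.left, ⊤)[X]}

/-- The projection to `W` of an open subscheme of `𝔸¹_W`. -/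
def proj (hτ : IsLineOpen τ e) : T ⟶ W := Over.homMk (τ ≫ Aff.pr 1 W.left) (by
  rw [Category.assoc]
  exact hτ.w)

/-- The coordinate function of an open subscheme of `𝔸¹_W`. -/
def coord (_ : IsLineOpen τ e) : Γ(T.left, ⊤) := τ.appTop (Aff.coord W.left 0)

lemma isUnit (hτ : IsLineOpen τ e) : IsUnit (e.eval₂ hτ.proj.left.appTop.hom hτ.coord) := by
  have := hτ.isOpenImmersion
  have h : IsUnit (τ.appTop (polyEval _ e)) := by
    refine isUnit_of_basicOpen_eq_top ?_
    rw [← Scheme.preimage_basicOpen_top, ← hτ.opensRange_eq]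
    exact Scheme.Hom.preimage_opensRange τ
  rwa [appTop_polyEval] at h

end IsLineOpen

namespace LineFr

variable {S : Scheme.{u}} {W T : Over S} {τ : T.left ⟶ Aff 1 W.left} {e : Γ(W.left, ⊤)[X]}

/-- A constant target coordinate equal to that of `T` means that the map to the target is the
projection to `T`. The data is then `σ_T` restricted to an open neighbourhood of the zero section.
-/
lemma toZF_eq_sigma (hτ : IsLineOpen τ e) (D : LineFr hτ.proj.left.appTop.hom e) (hψ : D.ψ = X)
    (hw : D.w = 1) (hy : D.y = C hτ.coord) : D.toZF hτ = ZF.sigma T := by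
  have hφ : D.ψ * D.w = X := by rw [hψ, hw, mul_one]
  refine ZF.mk_eq_of_equivalent (ExplicitFr.equivalent_of_restricts
    ⟨(D.toFr hτ).p, Category.comp_id _, fun i => ?_, ?_⟩ ?_)
  · change (D.toFr hτ).p.appTop (Aff.coord _ i) = (D.toFr hτ).p.appTop (polyEval _ (D.ψ * D.w))
    obtain rfl : i = 0 := Subsingleton.elim _ _
    rw [hφ, polyEval_X]
  · have := hτ.isOpenImmersion
    rw [← cancel_mono τ, g_comp]
    change (D.toFr hτ).p ≫ Aff.pr 1 T.left ≫ τ = (D.toFr hτ).p ≫ _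
    congr 1
    refine Aff.hom_ext ?_ fun i => ?_
    · rw [Category.assoc, Aff.lift_pr]
      rfl
    · obtain rfl : i = 0 := Subsingleton.elim _ _
      rw [Aff.comp_appTop, Aff.lift_coord, hy, polyEval_C]
      rfl
  · change (Aff 1 T.left).zeroLocus (Set.range (Aff.coord T.left)) ⊆ Set.range D.nbhd.ι
    rw [Scheme.Opens.range_ι]
    refine Set.Subset.trans (fun x hx => ?_) (zeroLocus_subset_basicOpen (D.coprime.map _))
    rw [hψ, polyEval_X]
    rw [Scheme.mem_zeroLocus_iff] at hx ⊢
    rintro _ rfl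
    exact hx _ ⟨0, rfl⟩

end LineFr

/-! ### Polynomial data for pairs -/

/-- The morphism `τ` identifies the pair `Q` with the pair of the open subschemes of `𝔸¹_W` where
`e`, respectively `e₀`, is invertible. -/
structure IsLinePair {S : Scheme.{u}} {W : Over S} {Q : Pair S} (τ : Q.X.left ⟶ Aff 1 W.left)
    (e e₀ : Γ(W.left, ⊤)[X]) : Prop where
  fst : IsLineOpen τ e
  snd : IsLineOpen (T := Q.openPart) (Q.incl.left ≫ τ) e₀

namespace LineFr

variable {S : Scheme.{u}} {W : Over S} {P P' Q Q' : Pair S} {τ : Q.X.left ⟶ Aff 1 W.left}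
  {τ' : Q'.X.left ⟶ Aff 1 W.left} {e e₀ e' e₀' : Γ(W.left, ⊤)[X]} {β : P.X ⟶ W} {β' : P'.X ⟶ W}

/-- The condition for polynomial data to define a framed correspondence of pairs. -/
def Admissible (D : LineFr β.left.appTop.hom e) (e₀ : Γ(W.left, ⊤)[X]) : Prop :=
  IsCoprime (D.ψ.map P.incl.left.appTop.hom)
    (e₀.eval₂ (C.comp (P.incl ≫ β).left.appTop.hom) (D.y.map P.incl.left.appTop.hom))

/-- The restriction of admissible polynomial data to the open part of a pair. -/
def restrict (D : LineFr β.left.appTop.hom e) (h : D.Admissible e₀) :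
    LineFr (P.incl ≫ β).left.appTop.hom e₀ where
  ψ := D.ψ.map P.incl.left.appTop.hom
  w := D.w.map P.incl.left.appTop.hom
  u := D.u.map P.incl.left.appTop.hom *
    e₀.eval₂ (C.comp (P.incl ≫ β).left.appTop.hom) (D.y.map P.incl.left.appTop.hom)
  y := D.y.map P.incl.left.appTop.hom
  dvd_monic := (D.map P.incl.left.appTop.hom rfl).dvd_monic
  w_dvd := (Polynomial.map_dvd _ D.w_dvd).mul_right _
  e_dvd := dvd_mul_left _ _
  coprime := (D.map P.incl.left.appTop.hom rfl).coprime.mul_right h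

/-- The element of `ℤF₁` of pairs given by admissible polynomial data. -/
def toPr (D : LineFr β.left.appTop.hom e) (hτ : IsLinePair τ e e₀) (h : D.Admissible e₀) :
    ZFpr 1 P Q :=
  ⟨(D.toZF hτ.fst, (D.restrict h).toZF hτ.snd), by
    rw [ZFpr.mem_iff, ofHom_comp_toZF D (D.map P.incl.left.appTop.hom rfl) hτ.fst P.incl rfl rfl rfl
      rfl]
    exact (toZF_comp_ofHom (D.map P.incl.left.appTop.hom rfl) hτ.fst (D.restrict h) hτ.snd Q.incl
      rfl rfl rfl rfl).symm⟩

lemma toPr_eq_add (D D₁ D₂ : LineFr β.left.appTop.hom e) (hτ : IsLinePair τ e e₀)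
    (h : D.Admissible e₀) (h₁ : D₁.Admissible e₀) (h₂ : D₂.Admissible e₀)
    (hψ : D.ψ = D₁.ψ * D₂.ψ) (hw₁ : D₁.w = D₂.ψ * D.w) (hw₂ : D₂.w = D₁.ψ * D.w)
    (hy₁ : D₁.y = D.y) (hy₂ : D₂.y = D.y) (hc : IsCoprime D₁.ψ D₂.ψ) :
    D.toPr hτ h = D₁.toPr hτ h₁ + D₂.toPr hτ h₂ := by
  refine Subtype.ext (Prod.ext (toZF_eq_add D D₁ D₂ _ hψ hw₁ hw₂ hy₁ hy₂ hc)
    (toZF_eq_add (D.restrict h) (D₁.restrict h₁) (D₂.restrict h₂) _ ?_ ?_ ?_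
      (congrArg (Polynomial.map _) hy₁) (congrArg (Polynomial.map _) hy₂) ?_))
  · exact (congrArg (Polynomial.map _) hψ).trans (Polynomial.map_mul _)
  · exact (congrArg (Polynomial.map _) hw₁).trans (Polynomial.map_mul _)
  · exact (congrArg (Polynomial.map _) hw₂).trans (Polynomial.map_mul _)
  · have := hc.map (mapRingHom P.incl.left.appTop.hom)
    rwa [coe_mapRingHom] at this

lemma toPr_comp_ofHom (D : LineFr β.left.appTop.hom e) (hτ : IsLinePair τ e e₀)
    (h : D.Admissible e₀) (D' : LineFr β.left.appTop.hom e') (hτ' : IsLinePair τ' e' e₀')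
    (h' : D'.Admissible e₀') (j : Pair.Hom Q' Q)
    (hj : j.hom.left ≫ τ = τ') (hψ : D'.ψ = D.ψ) (hw : D'.w = D.w) (hy : D'.y = D.y) :
    ZFpr.comp (add_zero 1) (D'.toPr hτ' h') (ZFpr.ofHom j) = D.toPr hτ h := by
  refine Subtype.ext (Prod.ext (toZF_comp_ofHom D hτ.fst D' hτ'.fst j.hom hj hψ hw hy)
    (toZF_comp_ofHom (D.restrict h) hτ.snd (D'.restrict h') hτ'.snd j.restrict ?_
      (congrArg (Polynomial.map _) hψ) (congrArg (Polynomial.map _) hw)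
      (congrArg (Polynomial.map _) hy)))
  have := congrArg (fun g => g.left) j.restrict_incl
  rw [← hj, ← Category.assoc, ← Category.assoc]
  exact congrArg (· ≫ τ) this

lemma ofHom_comp_toPr (D' : LineFr β'.left.appTop.hom e) (D : LineFr β.left.appTop.hom e)
    (hτ : IsLinePair τ e e₀) (h' : D'.Admissible e₀) (h : D.Admissible e₀) (f : Pair.Hom P P')
    (hf : f.hom ≫ β' = β)
    (hψ : D'.ψ.map f.hom.left.appTop.hom = D.ψ) (hw : D'.w.map f.hom.left.appTop.hom = D.w)
    (hy : D'.y.map f.hom.left.appTop.hom = D.y) :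
    ZFpr.comp (zero_add 1) (ZFpr.ofHom f) (D'.toPr hτ h') = D.toPr hτ h := by
  have key (p : Γ(P'.X.left, ⊤)[X]) :
      (p.map P'.incl.left.appTop.hom).map f.restrict.left.appTop.hom =
      (p.map f.hom.left.appTop.hom).map P.incl.left.appTop.hom := by
    rw [Polynomial.map_map, Polynomial.map_map]
    have := congrArg (fun g => g.left.appTop.hom) f.restrict_incl
    exact congrArg (fun g => p.map g) this
  refine Subtype.ext (Prod.ext (ofHom_comp_toZF D' D hτ.fst f.hom hf hψ hw hy)
    (ofHom_comp_toZF (D'.restrict h') (D.restrict h) hτ.snd f.restrict ?_ ?_ ?_ ?_))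
  · rw [← Category.assoc, f.restrict_incl, Category.assoc, hf]
  · exact (key _).trans (congrArg (Polynomial.map _) hψ)
  · exact (key _).trans (congrArg (Polynomial.map _) hw)
  · exact (key _).trans (congrArg (Polynomial.map _) hy)

/-- The projection of `𝔸¹ × P` to `W`. -/
def _root_.FramedCorr.Pair.lineProj (β : P.X ⟶ W) : P.affineLine.X ⟶ W :=
  Over.homMk (Aff.pr 1 P.X.left ≫ β.left) (by simp [Pair.affineLine])

/-- Turns a homotopy into a check of coefficients: data over `𝔸¹ × P` need only specialize at `0`
and `1` to the given `ψ`, `w` and `y`. -/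
lemma cls_toPr_eq (D : LineFr (Pair.lineProj β).left.appTop.hom e)
    (D₀ D₁ : LineFr β.left.appTop.hom e)
    (hτ : IsLinePair τ e e₀) (h : D.Admissible (P := P.affineLine) e₀) (h₀ : D₀.Admissible e₀)
    (h₁ : D₁.Admissible e₀)
    (H₀ : D.ψ.map (P.sectionAt 0).hom.left.appTop.hom = D₀.ψ ∧
      D.w.map (P.sectionAt 0).hom.left.appTop.hom = D₀.w ∧
      D.y.map (P.sectionAt 0).hom.left.appTop.hom = D₀.y)
    (H₁ : D.ψ.map (P.sectionAt 1).hom.left.appTop.hom = D₁.ψ ∧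
      D.w.map (P.sectionAt 1).hom.left.appTop.hom = D₁.w ∧
      D.y.map (P.sectionAt 1).hom.left.appTop.hom = D₁.y) :
    ZFpr.cls (D₀.toPr hτ h₀) = ZFpr.cls (D₁.toPr hτ h₁) := by
  have hs (c : Γ(P.X.left, ⊤)) : (P.sectionAt c).hom ≫ Pair.lineProj β = β := by
    ext1
    change Aff.lift (𝟙 _) (fun _ => c) ≫ Aff.pr 1 _ ≫ β.left = β.left
    simp
  have e₀ := ofHom_comp_toPr (P' := P.affineLine) D D₀ hτ h h₀ (P.sectionAt 0) (hs 0) H₀.1 H₀.2.1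
    H₀.2.2
  have e₁ := ofHom_comp_toPr (P' := P.affineLine) D D₁ hτ h h₁ (P.sectionAt 1) (hs 1) H₁.1 H₁.2.1
    H₁.2.2
  rw [← sub_eq_zero]
  refine (QuotientAddGroup.eq_zero_iff _).2 (AddSubgroup.mem_sup_left
    (AddSubgroup.subset_closure ⟨D.toPr (P := P.affineLine) hτ h, ?_⟩))
  rw [e₀, e₁]

end LineFr

/-! ### Polynomial identities -/

section Algebra

variable {R Λ : Type u} [CommRing R] [CommRing Λ]

lemma sub_eval_dvd (e y : Λ[X]) (t : Λ) : y - C t ∣ e.eval₂ C y - C (e.eval t) := by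
  have h := sub_dvd_eval_sub y (C t) (e.map C)
  rwa [Polynomial.eval_map, Polynomial.eval_map, eval₂_at_apply] at h

/-- Modulo `ψ` the polynomial `y` is the constant `t`, so `e(y)` becomes the unit `e(t)`. -/
lemma isCoprime_eval₂ {ρ : R →+* Λ} {e : R[X]} {t : Λ} (he : IsUnit (e.eval₂ ρ t)) {ψ y : Λ[X]}
    (h : ψ ∣ y - C t) : IsCoprime ψ (e.eval₂ (C.comp ρ) y) := by
  have h1 := h.trans (sub_eval_dvd (e.map ρ) y t)
  rw [eval₂_map, Polynomial.eval_map] at h1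
  obtain ⟨q, hq⟩ := h1
  obtain ⟨v, hv⟩ := he.exists_left_inv
  refine ⟨-(C v * q), C v, ?_⟩
  have h2 : C v * C (e.eval₂ ρ t) = 1 := by rw [← C_mul, hv, C_1]
  linear_combination C v * hq + h2

lemma eval₂_C_comp_X (ρ : R →+* Λ) (e : R[X]) : e.eval₂ (C.comp ρ) X = e.map ρ := rfl

lemma isCoprime_map {ρ : R →+* Λ} {e : R[X]} {t : Λ} (he : IsUnit (e.eval₂ ρ t)) :
    IsCoprime (X - C t) (e.map ρ) := by
  rw [← eval₂_C_comp_X]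
  exact isCoprime_eval₂ he dvd_rfl

/-- The Chinese remainder theorem for the coprime polynomials `e` and `X (X - t)`, whose product has
degree `deg e + 2`; a multiple of that product can be added to reach any degree `N` from there on.
Degrees are mentioned only over nontrivial rings, since over the zero ring `natDegree` is always
`0`. -/
lemma exists_monic_congr {e : Λ[X]} (he : e.Monic) {t : Λ} (h₀ : IsCoprime X e)
    (ht : IsCoprime (X - C t) e) {N : ℕ} (hN : Nontrivial Λ → e.natDegree + 2 ≤ N) :
    ∃ p : Λ[X], p.Monic ∧ (Nontrivial Λ → p.natDegree = N) ∧ e ∣ (X - C t) * p - 1 ∧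
      X * (X - C t) ∣ p - 1 := by
  obtain ⟨a, b, hab⟩ := IsCoprime.mul_left h₀ ht
  obtain ⟨c, d, hcd⟩ := ht
  have hM : (e * (X * (X - C t))).Monic := he.mul (monic_X.mul (monic_X_sub_C t))
  set M := e * (X * (X - C t)) with hMdef
  -- Modulo `e` this is `c`, the inverse of `X - t`; modulo `X (X - t)` it is `b e`, that is `1`.
  set p₀ := b * e + a * (X * (X - C t)) * c with hp₀
  have hmod := modByMonic_add_div p₀ M
  set q := X ^ (N - (e.natDegree + 2)) * M with hq
  have hqm : q.Monic := (monic_X_pow _).mul hM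
  have hle (_ : Nontrivial Λ) : M.degree ≤ q.degree := by
    rw [hq, hM.degree_mul, degree_X_pow, degree_eq_natDegree hM.ne_zero]
    exact_mod_cast Nat.le_add_left _ _
  refine ⟨q + p₀ %ₘ M, ?_, ?_, ?_, ?_⟩
  · rcases subsingleton_or_nontrivial Λ with _ | _
    · exact Subsingleton.elim _ _
    · exact hqm.add_of_left ((degree_modByMonic_lt _ hM).trans_le (hle inferInstance))
  · intro _
    have hlt : (p₀ %ₘ M).degree < q.degree :=
      (degree_modByMonic_lt _ hM).trans_le (hle inferInstance)
    rw [natDegree_add_eq_left_of_degree_lt hlt, hq, (monic_X_pow _).natDegree_mul hM, hMdef,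
      he.natDegree_mul (monic_X.mul (monic_X_sub_C t)), monic_X.natDegree_mul (monic_X_sub_C t),
      natDegree_X_pow, natDegree_X, natDegree_X_sub_C]
    have := hN inferInstance
    omega
  · have h1 : p₀ %ₘ M = p₀ - M * (p₀ /ₘ M) := by linear_combination hmod
    rw [h1]
    refine ⟨(X - C t) * (X ^ (N - (e.natDegree + 2)) * (X * (X - C t)) + b
      - (X * (X - C t)) * (p₀ /ₘ M)) - d - (X - C t) * b * c * 1, ?_⟩
    rw [hq, hp₀, hMdef]
    linear_combination hcd + (X - C t) * c * hab
  · have h1 : p₀ %ₘ M = p₀ - M * (p₀ /ₘ M) := by linear_combination hmod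
    rw [h1]
    refine ⟨X ^ (N - (e.natDegree + 2)) * e + a * c - a - e * (p₀ /ₘ M), ?_⟩
    rw [hq, hp₀, hMdef]
    linear_combination hab

/-- Two monic polynomials of equal degree differ by a polynomial of smaller degree, so every point
of the line joining them is monic. This is what keeps the support of the homotopy finite. -/
lemma monic_homotopy {Λ' : Type u} [CommRing Λ'] (κ : Λ →+* Λ') (c : Λ') {p q : Λ[X]}
    (hp : p.Monic) (hq : q.Monic) (h : Nontrivial Λ → p.natDegree = q.natDegree) :
    (p.map κ + C c * (q.map κ - p.map κ)).Monic := by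
  rcases subsingleton_or_nontrivial Λ' with _ | _
  · exact Subsingleton.elim _ _
  · have : Nontrivial Λ := κ.domain_nontrivial
    have hd : (q.map κ).degree = (p.map κ).degree := by
      rw [hp.degree_map, hq.degree_map, degree_eq_natDegree hp.ne_zero,
        degree_eq_natDegree hq.ne_zero, h this]
    refine (hp.map κ).add_of_left ?_
    rw [← smul_eq_C_mul, ← hd]
    refine (degree_smul_le _ _).trans_lt ?_
    exact degree_sub_lt_left hd (hq.map κ).ne_zero
      (by rw [(hp.map κ).leadingCoeff, (hq.map κ).leadingCoeff])

end Algebra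

/-! ### Polynomial data of the homotopies. -/

namespace LineFr

variable {R Λ : Type u} [CommRing R] [CommRing Λ]

/-- The data with support and framing the zero locus of `p + c (q - p)`. -/
def homotopy (ρ : R →+* Λ) (e : R[X]) (p q : Λ[X]) (c : Λ) (hm : (p + C c * (q - p)).Monic)
    (hp : e.map ρ ∣ p - 1) (hq : e.map ρ ∣ q - 1) : LineFr ρ e where
  ψ := p + C c * (q - p)
  w := 1
  u := e.map ρ
  y := X
  dvd_monic := ⟨_, hm, dvd_rfl⟩
  w_dvd := one_dvd _
  e_dvd := dvd_rfl
  coprime := by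
    obtain ⟨a, ha⟩ := hp
    obtain ⟨b, hb⟩ := hq
    -- Both ends are `1` modulo `e`, hence so is every point of the line joining them.
    exact ⟨1, -(a + C c * (b - a)), by linear_combination ha + C c * (hb - ha)⟩

/-- The data with support the graph of `t` and framing `(X - t) (p + c (1 - p))`. -/
def rescale (ρ : R →+* Λ) (e : R[X]) (t : Λ) (p : Λ[X]) (c : Λ) (ht : IsUnit (e.eval₂ ρ t))
    (hp : X - C t ∣ p - 1) : LineFr ρ e where
  ψ := X - C t
  w := p + C c * (1 - p)
  u := (p + C c * (1 - p)) * e.map ρ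
  y := X
  dvd_monic := ⟨_, monic_X_sub_C t, dvd_rfl⟩
  w_dvd := dvd_mul_right _ _
  e_dvd := dvd_mul_left _ _
  coprime := by
    obtain ⟨a, ha⟩ := hp
    -- Modulo `X - t` the factor `w` is `1` and `e` is the unit `e(t)`.
    exact IsCoprime.mul_right ⟨-(1 - C c) * a, 1, by linear_combination (1 - C c) * ha⟩
      (isCoprime_map ht)

/-- The data with support the graph of `t` and target coordinate `X + c (t - X)`. -/
def moveTarget (ρ : R →+* Λ) (e : R[X]) (t c : Λ) (ht : IsUnit (e.eval₂ ρ t)) : LineFr ρ e where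
  ψ := X - C t
  w := 1
  u := e.eval₂ (C.comp ρ) (X + C c * (C t - X))
  y := X + C c * (C t - X)
  dvd_monic := ⟨_, monic_X_sub_C t, dvd_rfl⟩
  w_dvd := one_dvd _
  e_dvd := dvd_rfl
  -- The moving coordinate satisfies `y - t = (1 - c) (X - t)`, so it equals `t` on the support
  -- throughout.
  coprime := isCoprime_eval₂ ht ⟨1 - C c, by ring⟩

/-- The data with support the graph of `t - c t` and target coordinate `t`. -/
def moveSupport (ρ : R →+* Λ) (e : R[X]) (t c : Λ) (ht : IsUnit (e.eval₂ ρ t)) : LineFr ρ e where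
  ψ := X - C (t - c * t)
  w := 1
  u := e.eval₂ (C.comp ρ) (C t)
  y := C t
  dvd_monic := ⟨_, monic_X_sub_C _, dvd_rfl⟩
  w_dvd := one_dvd _
  e_dvd := dvd_rfl
  coprime := isCoprime_eval₂ ht (by simp)

/-- The data with support the zero locus of `p` and framing `(X - t) p`, to the locus where
`X * e` is invertible. -/
def cofactor (ρ : R →+* Λ) (e : R[X]) (t : Λ) (p : Λ[X]) (hm : p.Monic)
    (hp : X * (X - C t) ∣ p - 1) (hq : e.map ρ ∣ (X - C t) * p - 1) : LineFr ρ (X * e) where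
  ψ := p
  w := X - C t
  u := (X - C t) * (X * e.map ρ)
  y := X
  dvd_monic := ⟨_, hm, dvd_rfl⟩
  w_dvd := dvd_mul_right _ _
  e_dvd := by
    rw [eval₂_mul, eval₂_X]
    exact dvd_mul_left _ _
  coprime := by
    obtain ⟨a, ha⟩ := hp
    obtain ⟨b, hb⟩ := hq
    -- The three factors of `u` are treated in turn: `p` is `1` modulo `X - t` and modulo `X`, and
    -- it is invertible modulo `e` with inverse `X - t`.
    exact IsCoprime.mul_right ⟨1, -(X * a), by linear_combination ha⟩
      (IsCoprime.mul_right ⟨1, -((X - C t) * a), by linear_combination ha⟩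
        ⟨X - C t, -b, by linear_combination hb⟩)

/-- Data for a smaller target define data for a larger target. -/
def ofDvd {ρ : R →+* Λ} {e e' : R[X]} (D : LineFr ρ e') (h : e ∣ e') : LineFr ρ e where
  ψ := D.ψ
  w := D.w
  u := D.u
  y := D.y
  dvd_monic := D.dvd_monic
  w_dvd := D.w_dvd
  e_dvd := (map_dvd (eval₂RingHom (C.comp ρ) D.y) h).trans D.e_dvd
  coprime := D.coprime

end LineFr

/-! ### The homotopies -/

namespace LineFr

variable {S : Scheme.{u}} {W : Over S} {P Q : Pair S} {τ : Q.X.left ⟶ Aff 1 W.left}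
  {e e₀ : Γ(W.left, ⊤)[X]} {β : P.X ⟶ W}

lemma admissible_of_dvd (D : LineFr β.left.appTop.hom e)
    (h : e₀.eval₂ (C.comp β.left.appTop.hom) D.y ∣ D.u) : D.Admissible e₀ := by
  have h1 := (D.coprime.of_isCoprime_of_dvd_right h).map (mapRingHom P.incl.left.appTop.hom)
  have h2 : (mapRingHom P.incl.left.appTop.hom).comp (C.comp β.left.appTop.hom) =
      C.comp (P.incl ≫ β).left.appTop.hom :=
    RingHom.ext fun r => Polynomial.map_C _
  rwa [hom_eval₂, coe_mapRingHom, h2] at h1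

/-- The hypothesis says that `s` vanishes at the points of the support that are sent to `0`. As `s`
is invertible on the open part of `P`, there are no such points over it. In the applications `s` is
the coordinate `t`. -/
lemma admissible (D : LineFr β.left.appTop.hom e) {s : Γ(P.X.left, ⊤)}
    (hs : IsUnit (P.incl.left.appTop s)) (h : ∃ a b, a * D.ψ + b * D.y = C s) :
    D.Admissible (X * e) := by
  rw [Admissible, eval₂_mul, eval₂_X]
  refine IsCoprime.mul_right ?_ (D.admissible_of_dvd D.e_dvd)
  obtain ⟨a, b, h⟩ := h
  obtain ⟨v, hv⟩ := hs.exists_left_inv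
  have h1 := congrArg (Polynomial.map P.incl.left.appTop.hom) h
  rw [Polynomial.map_add, Polynomial.map_mul, Polynomial.map_mul, map_C] at h1
  refine ⟨C v * a.map P.incl.left.appTop.hom, C v * b.map P.incl.left.appTop.hom, ?_⟩
  have h2 : (C v * C (P.incl.left.appTop.hom s) : Γ(P.openPart.left, ⊤)[X]) = 1 :=
    (C_mul).symm.trans ((congrArg C hv).trans C_1)
  linear_combination C v * h1 + h2

end LineFr

namespace Pair

variable {S : Scheme.{u}} {P : Pair S}

/-- The pullback of functions to `𝔸¹ × P`. -/
def κ (P : Pair S) : Γ(P.X.left, ⊤) →+* Γ(P.affineLine.X.left, ⊤) :=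
  (Aff.pr 1 P.X.left).appTop.hom

/-- The coordinate function of `𝔸¹ × P`. -/
def param (P : Pair S) : Γ(P.affineLine.X.left, ⊤) := Aff.coord P.X.left 0

lemma sectionAt_κ (c r : Γ(P.X.left, ⊤)) :
    (P.sectionAt c).hom.left.appTop.hom (P.κ r) = r := by
  change (Aff.lift (𝟙 _) fun _ => c).appTop ((Aff.pr 1 P.X.left).appTop r) = r
  rw [← Aff.comp_appTop, Aff.lift_pr]
  simp

lemma map_sectionAt_κ (c : Γ(P.X.left, ⊤)) (p : Γ(P.X.left, ⊤)[X]) :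
    (p.map P.κ).map (P.sectionAt c).hom.left.appTop.hom = p := by
  rw [Polynomial.map_map]
  convert Polynomial.map_id
  ext r
  exact sectionAt_κ c r

lemma sectionAt_param (c : Γ(P.X.left, ⊤)) :
    (P.sectionAt c).hom.left.appTop.hom P.param = c :=
  Aff.lift_coord (𝟙 P.X.left) (fun _ => c) 0

lemma isUnit_κ {s : Γ(P.X.left, ⊤)} (hs : IsUnit (P.incl.left.appTop s)) :
    IsUnit (P.affineLine.incl.left.appTop (P.κ s)) := by
  let g : P.affineLine.openPart.left ⟶ P.openPart.left :=
    (Aff.pr 1 P.X.left).resLE P.V P.affineLine.V le_rfl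
  have hg : g ≫ P.incl.left = P.affineLine.incl.left ≫ Aff.pr 1 P.X.left :=
    Scheme.Hom.resLE_comp_ι _ _
  have h1 : g.appTop (P.incl.left.appTop s) = P.affineLine.incl.left.appTop (P.κ s) :=
    congrArg (fun f => f.appTop s) hg
  rw [← h1]
  exact hs.map g.appTop.hom

end Pair

lemma IsLineOpen.of_isIso {S : Scheme.{u}} {W T T' : Over S} {τ : T.left ⟶ Aff 1 W.left}
    {e : Γ(W.left, ⊤)[X]} (h : IsLineOpen τ e) (j : T' ⟶ T) [IsIso j.left] :
    IsLineOpen (j.left ≫ τ) e where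
  w := by rw [Category.assoc, h.w, Over.w]
  isOpenImmersion := by
    have := h.isOpenImmersion
    infer_instance
  opensRange_eq := by
    have := h.isOpenImmersion
    rw [← h.opensRange_eq]
    exact Scheme.Hom.opensRange_comp_of_isIso _ _

namespace IsLinePair

variable {S : Scheme.{u}} {W : Over S} {P Q : Pair S} {τ : Q.X.left ⟶ Aff 1 W.left}
  {e : Γ(W.left, ⊤)[X]} {β : P.X ⟶ W}

lemma isUnit_coord (hτ : IsLinePair τ e (X * e)) :
    IsUnit (Q.incl.left.appTop hτ.fst.coord) := by
  have h := hτ.snd.isUnit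
  rw [eval₂_mul, eval₂_X] at h
  exact isUnit_of_mul_isUnit_left h

/-- Data with values in the locus where `X * e` is invertible land in the open part `E` of `Q`, over
all of `P`. Such a correspondence factors through the pair `(E, E)`. -/
lemma cls_eq_zero (hτ : IsLinePair τ e (X * e)) (hE : IsEssentiallySmooth Q.openPart)
    (D : LineFr β.left.appTop.hom (X * e)) (h : (D.ofDvd (dvd_mul_left e X)).Admissible (X * e)) :
    ZFpr.cls ((D.ofDvd (dvd_mul_left e X)).toPr hτ h) = 0 := by
  let E : Pair S := ⟨Q.openPart, ⊤⟩
  have hiso : IsIso E.incl.left :=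
    inferInstanceAs (IsIso Q.openPart.left.topIso.hom)
  have hE' : IsLinePair (Q := E) (Q.incl.left ≫ τ) (X * e) (X * e) :=
    ⟨hτ.snd, hτ.snd.of_isIso E.incl⟩
  let j : Pair.Hom E Q := ⟨Q.incl, by
    change ⊤ ≤ Q.V.ι ⁻¹ᵁ Q.V
    rw [Scheme.Opens.ι_preimage_self]⟩
  refine (QuotientAddGroup.eq_zero_iff _).2 (AddSubgroup.mem_sup_right
    (AddSubgroup.subset_closure ⟨1, 0, add_zero 1, Q.openPart, hE,
      D.toPr hE' (D.admissible_of_dvd D.e_dvd), ZFpr.ofHom j, ?_⟩))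
  exact (LineFr.toPr_comp_ofHom _ hτ h D hE' (D.admissible_of_dvd D.e_dvd) j rfl rfl rfl rfl).symm

end IsLinePair

namespace Pair

variable {S : Scheme.{u}} {W : Over S} {P : Pair S} {e : Γ(W.left, ⊤)[X]} (β : P.X ⟶ W)

lemma map_lineProj (e : Γ(W.left, ⊤)[X]) :
    e.map (lineProj β).left.appTop.hom = (e.map β.left.appTop.hom).map P.κ :=
  (Polynomial.map_map _ _ _).symm

lemma isUnit_eval₂_lineProj {t : Γ(P.X.left, ⊤)} (h : IsUnit (e.eval₂ β.left.appTop.hom t)) :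
    IsUnit (e.eval₂ (lineProj β).left.appTop.hom (P.κ t)) := by
  have h1 := h.map P.κ
  rw [hom_eval₂] at h1
  exact h1

end Pair

namespace IsLinePair

open LineFr

variable {S : Scheme.{u}} {W : Over S} {P Q : Pair S} {τ : Q.X.left ⟶ Aff 1 W.left}
  {e : Γ(W.left, ⊤)[X]} {β : P.X ⟶ W}

/-- The straight line from `p` to `q`. The last two divisibilities say `p(0) = q(0) = -t`; this
persists along the line, so `ψ + t` stays divisible by the target coordinate `X`, which is the
relation required by `admissible`. -/
lemma cls_homotopy (hτ : IsLinePair τ e (X * e)) {t : Γ(P.X.left, ⊤)}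
    (ht : IsUnit (P.incl.left.appTop t)) {p q : Γ(P.X.left, ⊤)[X]} (hpm : p.Monic)
    (hqm : q.Monic) (hd : Nontrivial Γ(P.X.left, ⊤) → p.natDegree = q.natDegree)
    (hp : e.map β.left.appTop.hom ∣ p - 1) (hq : e.map β.left.appTop.hom ∣ q - 1)
    (hpt : X ∣ p + C t) (hqt : X ∣ q + C t) (D₀ D₁ : LineFr β.left.appTop.hom e)
    (h₀ : D₀.Admissible (X * e)) (h₁ : D₁.Admissible (X * e))
    (e₀ : D₀.ψ = p ∧ D₀.w = 1 ∧ D₀.y = X) (e₁ : D₁.ψ = q ∧ D₁.w = 1 ∧ D₁.y = X) :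
    ZFpr.cls (D₀.toPr hτ h₀) = ZFpr.cls (D₁.toPr hτ h₁) := by
  have key {p : Γ(P.X.left, ⊤)[X]} (hp : e.map β.left.appTop.hom ∣ p - 1) :
      e.map (Pair.lineProj β).left.appTop.hom ∣ p.map P.κ - 1 := by
    have := Polynomial.map_dvd P.κ hp
    rwa [Polynomial.map_sub, Polynomial.map_one, ← Pair.map_lineProj] at this
  let D : LineFr (Pair.lineProj β).left.appTop.hom e :=
    homotopy _ e (p.map P.κ) (q.map P.κ) P.param (monic_homotopy _ _ hpm hqm hd) (key hp) (key hq)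
  have hD : D.Admissible (P := P.affineLine) (X * e) := by
    refine admissible (P := P.affineLine) D (Pair.isUnit_κ ht) ?_
    obtain ⟨a, ha⟩ := hpt
    obtain ⟨b, hb⟩ := hqt
    refine ⟨-1, a.map P.κ + C P.param * (b.map P.κ - a.map P.κ), ?_⟩
    have ha' := congrArg (Polynomial.map P.κ) ha
    have hb' := congrArg (Polynomial.map P.κ) hb
    simp only [Polynomial.map_add, Polynomial.map_mul, map_X, map_C] at ha' hb'
    change -1 * (p.map P.κ + C P.param * (q.map P.κ - p.map P.κ)) + _ * X = _
    linear_combination (C P.param - 1) * ha' - C P.param * hb'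
  refine cls_toPr_eq D D₀ D₁ hτ hD h₀ h₁ ⟨?_, ?_, ?_⟩ ⟨?_, ?_, ?_⟩ <;>
    simp only [e₀, e₁, D, homotopy, Polynomial.map_add, Polynomial.map_mul, Polynomial.map_sub,
      Pair.map_sectionAt_κ, map_C, map_X, Polynomial.map_one, Pair.sectionAt_param, C_0,
      C_1] <;>
    ring

/-- On the graph `X = t` the unit `p` is `1`, so it may be joined to `1` linearly without vanishing
on the support. -/
lemma cls_rescale (hτ : IsLinePair τ e (X * e)) {t : Γ(P.X.left, ⊤)}
    (ht : IsUnit (P.incl.left.appTop t)) (het : IsUnit (e.eval₂ β.left.appTop.hom t))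
    {p : Γ(P.X.left, ⊤)[X]} (hp : X - C t ∣ p - 1) (D₀ D₁ : LineFr β.left.appTop.hom e)
    (h₀ : D₀.Admissible (X * e)) (h₁ : D₁.Admissible (X * e))
    (e₀ : D₀.ψ = X - C t ∧ D₀.w = p ∧ D₀.y = X) (e₁ : D₁.ψ = X - C t ∧ D₁.w = 1 ∧ D₁.y = X) :
    ZFpr.cls (D₀.toPr hτ h₀) = ZFpr.cls (D₁.toPr hτ h₁) := by
  have hp' : X - C (P.κ t) ∣ p.map P.κ - 1 := by
    have := Polynomial.map_dvd P.κ hp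
    rwa [Polynomial.map_sub, Polynomial.map_sub, map_C, map_X, Polynomial.map_one] at this
  let D : LineFr (Pair.lineProj β).left.appTop.hom e :=
    rescale _ e (P.κ t) (p.map P.κ) P.param (Pair.isUnit_eval₂_lineProj β het) hp'
  have hD : D.Admissible (P := P.affineLine) (X * e) := by
    refine admissible (P := P.affineLine) D (Pair.isUnit_κ ht) ⟨-1, 1, ?_⟩
    change -1 * (X - C (P.κ t)) + 1 * X = _
    ring
  refine cls_toPr_eq D D₀ D₁ hτ hD h₀ h₁ ⟨?_, ?_, ?_⟩ ⟨?_, ?_, ?_⟩ <;>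
    simp only [e₀, e₁, D, rescale, Polynomial.map_add, Polynomial.map_mul, Polynomial.map_sub,
      Pair.map_sectionAt_κ, Pair.sectionAt_κ, map_C, map_X, Polynomial.map_one,
      Pair.sectionAt_param, C_0, C_1] <;>
    ring

/-- `X` and `t` agree on the support, so the interpolated target coordinate equals `t` there; it can
be `0` only where `t` is. -/
lemma cls_moveTarget (hτ : IsLinePair τ e (X * e)) {t : Γ(P.X.left, ⊤)}
    (ht : IsUnit (P.incl.left.appTop t)) (het : IsUnit (e.eval₂ β.left.appTop.hom t))
    (D₀ D₁ : LineFr β.left.appTop.hom e)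
    (h₀ : D₀.Admissible (X * e)) (h₁ : D₁.Admissible (X * e))
    (e₀ : D₀.ψ = X - C t ∧ D₀.w = 1 ∧ D₀.y = X) (e₁ : D₁.ψ = X - C t ∧ D₁.w = 1 ∧ D₁.y = C t) :
    ZFpr.cls (D₀.toPr hτ h₀) = ZFpr.cls (D₁.toPr hτ h₁) := by
  let D : LineFr (Pair.lineProj β).left.appTop.hom e :=
    moveTarget _ e (P.κ t) P.param (Pair.isUnit_eval₂_lineProj β het)
  have hD : D.Admissible (P := P.affineLine) (X * e) := by
    refine admissible (P := P.affineLine) D (Pair.isUnit_κ ht) ⟨-(1 - C P.param), 1, ?_⟩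
    change -(1 - C P.param) * (X - C (P.κ t)) + 1 * (X + C P.param * (C (P.κ t) - X)) = _
    ring
  refine cls_toPr_eq D D₀ D₁ hτ hD h₀ h₁ ⟨?_, ?_, ?_⟩ ⟨?_, ?_, ?_⟩ <;>
    simp only [e₀, e₁, D, moveTarget, Polynomial.map_add, Polynomial.map_mul, Polynomial.map_sub,
      Pair.sectionAt_κ, map_C, map_X, Polynomial.map_one, Pair.sectionAt_param, C_0, C_1] <;>
    ring

/-- Once the target coordinate is the constant `t`, the conditions on the target no longer involve
the support, which can slide freely along the graphs of `(1 - c) t`. -/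
lemma cls_moveSupport (hτ : IsLinePair τ e (X * e)) {t : Γ(P.X.left, ⊤)}
    (ht : IsUnit (P.incl.left.appTop t)) (het : IsUnit (e.eval₂ β.left.appTop.hom t))
    (D₀ D₁ : LineFr β.left.appTop.hom e)
    (h₀ : D₀.Admissible (X * e)) (h₁ : D₁.Admissible (X * e))
    (e₀ : D₀.ψ = X - C t ∧ D₀.w = 1 ∧ D₀.y = C t) (e₁ : D₁.ψ = X ∧ D₁.w = 1 ∧ D₁.y = C t) :
    ZFpr.cls (D₀.toPr hτ h₀) = ZFpr.cls (D₁.toPr hτ h₁) := by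
  let D : LineFr (Pair.lineProj β).left.appTop.hom e :=
    moveSupport _ e (P.κ t) P.param (Pair.isUnit_eval₂_lineProj β het)
  have hD : D.Admissible (P := P.affineLine) (X * e) := by
    refine admissible (P := P.affineLine) D (Pair.isUnit_κ ht) ⟨0, 1, ?_⟩
    change 0 * _ + 1 * C (P.κ t) = _
    ring
  refine cls_toPr_eq D D₀ D₁ hτ hD h₀ h₁ ⟨?_, ?_, ?_⟩ ⟨?_, ?_, ?_⟩ <;>
    simp only [e₀, e₁, D, moveSupport, C_sub, C_mul, Polynomial.map_sub, Polynomial.map_mul,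
      Pair.sectionAt_κ, map_C, map_X, Polynomial.map_one, Pair.sectionAt_param, C_0, C_1] <;>
    ring

/-- A monic polynomial `h ≡ 1 mod e` with `h(0) = -t` represents `σ`. -/
theorem cls_toPr_eq_sigma (hτ : IsLinePair τ e (X * e)) (hE : IsEssentiallySmooth Q.openPart)
    (he : e.Monic) (he0 : IsUnit (e.eval 0)) (D : LineFr hτ.fst.proj.left.appTop.hom e)
    (hD : D.Admissible (X * e)) (hm : D.ψ.Monic) (hw : D.w = 1) (hy : D.y = X)
    (h1 : e.map hτ.fst.proj.left.appTop.hom ∣ D.ψ - 1) (h2 : X ∣ D.ψ + C hτ.fst.coord)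
    (hd : Nontrivial Γ(Q.X.left, ⊤) → e.natDegree + 3 ≤ D.ψ.natDegree) :
    ZFpr.cls (D.toPr hτ hD) = ZFpr.cls (ZFpr.sigma Q) := by
  set t := hτ.fst.coord
  let ρ := hτ.fst.proj.left.appTop.hom
  have htu : IsUnit (Q.incl.left.appTop t) := hτ.isUnit_coord
  have het : IsUnit (e.eval₂ ρ t) := hτ.fst.isUnit
  have he0' : IsUnit (e.eval₂ ρ 0) := by
    have := he0.map ρ
    rwa [← eval₂_at_apply, map_zero] at this
  have hX : IsCoprime X (e.map ρ) := by simpa using isCoprime_map he0'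
  -- The degree is one less than that of `D.ψ`, so that `(X - t) p` can be joined to it by monic
  -- polynomials. The bound `deg e + 3` in the hypothesis becomes the bound `deg e + 2` needed here.
  obtain ⟨p, hpm, hpd, hp₁, hp₂⟩ := exists_monic_congr (N := D.ψ.natDegree - 1) (he.map ρ) hX
    (isCoprime_map het) (fun hn => by
      have := hd hn
      rw [he.natDegree_map]
      omega)
  have hqm : ((X - C t) * p).Monic := (monic_X_sub_C t).mul hpm
  have hqd (hn : Nontrivial Γ(Q.X.left, ⊤)) : D.ψ.natDegree = ((X - C t) * p).natDegree := by
    rw [(monic_X_sub_C t).natDegree_mul hpm, natDegree_X_sub_C, hpd hn]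
    have := hd hn
    omega
  have hq2 : X ∣ (X - C t) * p + C t := by
    obtain ⟨a, ha⟩ := hp₂
    exact ⟨p - C t * (X - C t) * a, by linear_combination -C t * ha⟩
  have hpt : X - C t ∣ p - 1 := (dvd_mul_left _ _).trans hp₂
  -- A homotopy frozen at one parameter is used as a constructor: here the constant one, and below
  -- `rescale` at `0` and `moveTarget`, `moveSupport` at `1`.
  let Dq : LineFr ρ e := homotopy ρ e ((X - C t) * p) ((X - C t) * p) 0 (by simpa using hqm) hp₁ hp₁
  have hDqψ : Dq.ψ = (X - C t) * p := by simp [Dq, homotopy]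
  have aDq : Dq.Admissible (X * e) := by
    refine admissible Dq htu ?_
    obtain ⟨a, ha⟩ := hq2
    refine ⟨-1, a, ?_⟩
    rw [hDqψ]
    change _ + a * X = _
    linear_combination -ha
  let Da : LineFr ρ e := rescale ρ e t p 0 het hpt
  have hDaw : Da.w = p := by simp [Da, rescale]
  have aDa : Da.Admissible (X * e) := admissible Da htu
    ⟨-1, 1, by change -1 * (X - C t) + 1 * X = _; ring⟩
  -- The summand supported on `p = 0`; since `p ≡ 1` modulo `X`, its target is the open part of `Q`.
  let Db : LineFr ρ (X * e) := cofactor ρ e t p hpm hp₂ hp₁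
  have aDb : (Db.ofDvd (dvd_mul_left e X)).Admissible (X * e) := admissible_of_dvd _ Db.e_dvd
  let D1 : LineFr ρ e := rescale ρ e t 1 0 het (by simp)
  have aD1 : D1.Admissible (X * e) := admissible D1 htu
    ⟨-1, 1, by change -1 * (X - C t) + 1 * X = _; ring⟩
  let D2 : LineFr ρ e := moveTarget ρ e t 1 het
  have hD2y : D2.y = C t := by simp [D2, moveTarget]
  have aD2 : D2.Admissible (X * e) := admissible D2 htu ⟨0, 1, by rw [hD2y]; ring⟩
  let D3 : LineFr ρ e := moveSupport ρ e t 1 het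
  have hD3 : D3.ψ = X := by simp [D3, moveSupport]
  have aD3 : D3.Admissible (X * e) := admissible D3 htu ⟨0, 1, by
    change 0 * _ + 1 * C t = _
    ring⟩
  -- Replace `D.ψ` by `(X - t) p`, and split the result into the part on the graph of `t` and the
  -- part on the zeros of `p`.
  rw [cls_homotopy hτ htu hm hqm hqd h1 hp₁ h2 hq2 D Dq hD aDq ⟨rfl, hw, hy⟩ ⟨hDqψ, rfl, rfl⟩,
    toPr_eq_add Dq Da (Db.ofDvd (dvd_mul_left e X)) hτ aDq aDa aDb hDqψ
      (hDaw.trans (mul_one p).symm) (mul_one (X - C t)).symm rfl rfl ?_]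
  · change ZFpr.cls (Da.toPr hτ aDa) + ZFpr.cls ((Db.ofDvd _).toPr hτ aDb) = _
    rw [cls_eq_zero hτ hE Db aDb, add_zero,
      cls_rescale hτ htu het hpt Da D1 aDa aD1 ⟨rfl, hDaw, rfl⟩
        ⟨rfl, by simp [D1, rescale], rfl⟩,
      cls_moveTarget hτ htu het D1 D2 aD1 aD2 ⟨rfl, by simp [D1, rescale], rfl⟩ ⟨rfl, rfl, hD2y⟩,
      cls_moveSupport hτ htu het D2 D3 aD2 aD3 ⟨rfl, rfl, hD2y⟩ ⟨hD3, rfl, rfl⟩]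
    refine congrArg ZFpr.cls (Subtype.ext (Prod.ext (toZF_eq_sigma hτ.fst D3 hD3 rfl rfl)
      (toZF_eq_sigma hτ.snd (D3.restrict aD3) ?_ ?_ ?_)))
    · exact (congrArg (Polynomial.map _) hD3).trans (map_X _)
    · exact Polynomial.map_one _
    · exact map_C _
  -- The two supports are disjoint because `p ≡ 1` modulo `X - t`.
  · obtain ⟨a, ha⟩ := hpt
    exact ⟨-a, 1, by
      change -a * (X - C t) + 1 * p = 1
      linear_combination ha⟩

end IsLinePair

/-! ### Essential smoothness -/

/-- Affine space over `X` is the base change of `Spec ℤ[x₁, …, xₙ]` over the terminal scheme `Spec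
ℤ`. -/
instance smooth_pr (n : ℕ) (X : Scheme.{u}) : Smooth (Aff.pr n X) := by
  have h : Smooth (terminal.from
      (Spec (.of (MvPolynomial (ULift.{u} (Fin n)) (ULift.{u} ℤ))))) := by
    have := isIso_of_isTerminal specULiftZIsTerminal.{u} terminalIsTerminal (terminal.from _)
    rw [← terminal.comp_from (Spec.map (CommRingCat.ofHom MvPolynomial.C))]
    have : Smooth (Spec.map (CommRingCat.ofHom
        (MvPolynomial.C : ULift.{u} ℤ →+* MvPolynomial (ULift.{u} (Fin n)) (ULift.{u} ℤ)))) := by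
      rw [HasRingHomProperty.Spec_iff (P := @Smooth)]
      have h : Algebra.Smooth (ULift.{u} ℤ) (MvPolynomial (ULift.{u} (Fin n)) (ULift.{u} ℤ)) :=
        ⟨inferInstance, inferInstance⟩
      exact (RingHom.smooth_algebraMap).2 h
    infer_instance
  exact (inferInstance : MorphismProperty.IsStableUnderBaseChange @Smooth).of_isPullback
    (IsPullback.of_hasPullback (terminal.from X) (terminal.from _)).flip h

instance flat_fromSpecStalk (X : Scheme.{u}) (x : X) : Flat (X.fromSpecStalk x) := by
  have (U : X.Opens) (hU : IsAffineOpen U) (hx : x ∈ U) : Flat (hU.fromSpecStalk hx) := by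
    have : Flat (Spec.map (X.presheaf.germ U x hx)) := by
      rw [Flat.SpecMap_iff]
      let _ : Algebra Γ(X, U) (X.presheaf.stalk x) := (X.presheaf.germ U x hx).hom.toAlgebra
      have := hU.isLocalization_stalk ⟨x, hx⟩
      exact IsLocalization.flat (X.presheaf.stalk x) (hU.primeIdealOf ⟨x, hx⟩).asIdeal.primeCompl
    rw [IsAffineOpen.fromSpecStalk]
    infer_instance
  exact this _ (isAffineOpen_opensRange (X.affineCover.f (X.affineCover.idx x))) _

/-- Stalk maps of a preimmersion are surjective; a flat local homomorphism is faithfully flat, hence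
injective. -/
lemma isIso_stalkMap_of_flat {X Y : Scheme.{u}} (f : X ⟶ Y) [IsPreimmersion f] [Flat f] (x : X) :
    IsIso (f.stalkMap x) := by
  have hs : Function.Surjective (f.stalkMap x) := f.stalkMap_surjective x
  have hi : Function.Injective (f.stalkMap x) := by
    algebraize [(f.stalkMap x).hom]
    have := Flat.stalkMap f x
    have := @Module.FaithfullyFlat.of_flat_of_isLocalHom _ _ _ _ _ _ _ (Flat.stalkMap f x)
      (f.toLRSHom.prop x)
    exact FaithfulSMul.algebraMap_injective _ _
  exact (ConcreteCategory.isIso_iff_bijective _).2 ⟨hi, hs⟩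

/-- The smooth scheme localized to `T` is `𝔸¹_X`: the map from `𝔸¹` over `Spec 𝒪_{X,x}` to it is a
base change of `Spec 𝒪_{X,x} ⟶ X`, hence a flat preimmersion, and remains so after restriction to an
open subscheme. -/
lemma IsLineOpen.isEssentiallySmooth {S : Scheme.{u}} {X T : Over S} {x : X.left}
    (hsm : Smooth X.hom) (hsep : IsSeparated X.hom) (hqc : QuasiCompact X.hom)
    {τ : T.left ⟶ Aff 1 (localScheme X x).left} {e : Γ((localScheme X x).left, ⊤)[X]}
    (hτ : IsLineOpen τ e) : IsEssentiallySmooth T := by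
  have := hτ.isOpenImmersion
  let s : Aff 1 (localScheme X x).left ⟶ Aff 1 X.left := AffineSpace.map _ (X.left.fromSpecStalk x)
  have hs : IsPullback s (Aff.pr 1 _) (Aff.pr 1 _) (X.left.fromSpecStalk x) :=
    AffineSpace.isPullback_map _
  have h1 : IsPreimmersion s :=
    (inferInstance : MorphismProperty.IsStableUnderBaseChange @IsPreimmersion).of_isPullback
      hs.flip (inferInstanceAs (IsPreimmersion (Scheme.fromSpecStalk X.left x)))
  have h2 : Flat s :=
    (inferInstance : MorphismProperty.IsStableUnderBaseChange @Flat).of_isPullback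
      hs.flip (flat_fromSpecStalk X.left x)
  have hw : (τ ≫ s) ≫ Aff.pr 1 X.left ≫ X.hom = T.hom := by
    rw [← hτ.w, Category.assoc, reassoc_of% hs.w]
    rfl
  refine ⟨Over.mk (Aff.pr 1 X.left ≫ X.hom), Over.homMk (τ ≫ s) hw, ?_, ?_, ?_, ?_, ?_⟩
  · change Smooth (Aff.pr 1 X.left ≫ X.hom)
    infer_instance
  · change IsSeparated (Aff.pr 1 X.left ≫ X.hom)
    infer_instance
  · change QuasiCompact (Aff.pr 1 X.left ≫ X.hom)
    infer_instance
  · exact (τ ≫ s).isEmbedding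
  · exact isIso_stalkMap_of_flat (τ ≫ s)

/-! ### The pairs of the theorem -/

lemma isLinePair_of_isOpenImmersion {S : Scheme.{u}} {W : Over S} {Q : Pair S}
    (τ : Q.X.left ⟶ Aff 1 W.left) (hτ : IsOpenImmersion τ) {e : Γ(W.left, ⊤)[X]}
    (hw : τ ≫ Aff.pr 1 W.left ≫ W.hom = Q.X.hom)
    (h : τ.opensRange = (Aff 1 W.left).basicOpen (polyEval _ e))
    (hV : Q.V = τ ⁻¹ᵁ (Aff 1 W.left).basicOpen (Aff.coord W.left 0)) :
    IsLinePair τ e (X * e) where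
  fst := ⟨hw, hτ, h⟩
  snd := by
    refine ⟨?_, ?_, ?_⟩
    · rw [Category.assoc, hw]
      exact Over.w Q.incl
    · exact inferInstanceAs (IsOpenImmersion (Q.V.ι ≫ τ))
    · apply SetLike.coe_injective
      change Set.range (Q.V.ι ≫ τ) = _
      rw [Scheme.Hom.comp_base, TopCat.coe_comp, Set.range_comp, Scheme.Opens.range_ι, hV, map_mul,
        polyEval_X, Scheme.basicOpen_mul, ← h]
      exact Set.image_preimage_eq_inter_range (f := τ)
        (t := (Aff 1 W.left).basicOpen (Aff.coord W.left 0))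

lemma isLinePair_linePair {S : Scheme.{u}} (W : Over S) :
    IsLinePair (Q := linePair W) (𝟙 (Aff 1 W.left)) 1 (X * 1) :=
  isLinePair_of_isOpenImmersion (Q := linePair W) (𝟙 (Aff 1 W.left))
    (inferInstanceAs (IsOpenImmersion (𝟙 (Aff 1 W.left)))) (Category.id_comp _)
    (by
      rw [map_one, Scheme.basicOpen_of_isUnit _ isUnit_one]
      exact Scheme.Hom.opensRange_of_isIso (𝟙 (Aff 1 W.left))) rfl

lemma isLinePair_restrict {S : Scheme.{u}} (W : Over S) (F : Γ(W.left, ⊤)[X])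
    (U : (Aff 1 W.left).Opens) (hU : U = (Aff 1 W.left).basicOpen (polyEval _ F)) :
    IsLinePair (Q := (linePair W).restrict U) U.ι F (X * F) :=
  isLinePair_of_isOpenImmersion (Q := (linePair W).restrict U) U.ι
    (inferInstanceAs (IsOpenImmersion (Scheme.Opens.ι U))) rfl
    (by rw [← hU]; exact Scheme.Opens.opensRange_ι U) rfl

/-! ### Excision on the relative affine line -/

section Algebra

variable {Λ : Type u} [CommRing Λ]

/-- A monic polynomial congruent to `1` modulo `e` with constant coefficient `-t`, where `b` is the
inverse of the constant coefficient of `e`. -/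
def excisionPoly (e : Λ[X]) (b t : Λ) : Λ[X] := X ^ 3 * e + (1 - C ((1 + t) * b) * e)

variable {e : Λ[X]} {b t : Λ}

lemma dvd_excisionPoly_sub_one : e ∣ excisionPoly e b t - 1 :=
  ⟨X ^ 3 - C ((1 + t) * b), by rw [excisionPoly]; ring⟩

/-- The coefficient `(1 + t) b` is chosen so that the value at `0` is `1 - (1 + t) b e(0) = -t`. -/
lemma X_dvd_excisionPoly_add (h : b * e.eval 0 = 1) : X ∣ excisionPoly e b t + C t := by
  rw [X_dvd_iff, coeff_zero_eq_eval_zero]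
  simp only [excisionPoly, eval_add, eval_mul, eval_pow, eval_X, eval_sub, eval_one, eval_C]
  linear_combination -(1 + t) * h

lemma degree_one_sub_C_mul_lt [Nontrivial Λ] (he : e.Monic) :
    (1 - C ((1 + t) * b) * e).degree < (X ^ 3 * e).degree := by
  have h1 : (X ^ 3 * e).degree = ((e.natDegree + 3 : ℕ) : WithBot ℕ) := by
    rw [he.degree_mul, degree_X_pow, degree_eq_natDegree he.ne_zero, add_comm]
    rfl
  rw [h1, degree_lt_iff_coeff_zero]
  intro m hm
  rw [coeff_sub, coeff_C_mul, coeff_one, if_neg (by omega),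
    coeff_eq_zero_of_natDegree_lt (by omega), mul_zero, sub_zero]

lemma monic_excisionPoly (he : e.Monic) : (excisionPoly e b t).Monic := by
  rcases subsingleton_or_nontrivial Λ with _ | _
  · exact Subsingleton.elim _ _
  · exact ((monic_X_pow 3).mul he).add_of_left (degree_one_sub_C_mul_lt he)

/-- The exponent `3` makes the degree just large enough for `IsLinePair.cls_toPr_eq_sigma`. -/
lemma natDegree_excisionPoly [Nontrivial Λ] (he : e.Monic) :
    (excisionPoly e b t).natDegree = e.natDegree + 3 := by
  rw [excisionPoly, natDegree_add_eq_left_of_degree_lt (degree_one_sub_C_mul_lt he),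
    (monic_X_pow 3).natDegree_mul he, natDegree_X_pow, add_comm]

lemma map_excisionPoly {Λ' : Type u} [CommRing Λ'] (θ : Λ →+* Λ') :
    (excisionPoly e b t).map θ = excisionPoly (e.map θ) (θ b) (θ t) := by
  simp [excisionPoly]

lemma map_mul_eval_zero {Λ' : Type u} [CommRing Λ'] (θ : Λ →+* Λ') (h : b * e.eval 0 = 1) :
    θ b * (e.map θ).eval 0 = 1 := by
  rw [Polynomial.eval_map, ← map_zero θ, eval₂_at_apply, ← map_mul, h, map_one]

end Algebra

/-- Excision on the affine line over `W`, if the loci of invertibility of `X` and of `X * F` are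
essentially smooth. -/
theorem exists_excision {S : Scheme.{u}} (W : Over S) (F : Γ(W.left, ⊤)[X]) (hF : F.Monic)
    (hF0 : IsUnit (F.eval 0)) (U : (Aff 1 W.left).Opens)
    (hU : U = (Aff 1 W.left).basicOpen (polyEval _ F))
    (hE : IsEssentiallySmooth (linePair W).openPart)
    (hE' : IsEssentiallySmooth ((linePair W).restrict U).openPart) :
    ∃ r : ZFpr 1 (linePair W) ((linePair W).restrict U),
      ZFpr.cls (ZFpr.comp (add_zero 1) r (ZFpr.ofHom ((linePair W).restrictHom U))) =
        ZFpr.cls (ZFpr.sigma (linePair W)) ∧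
      ZFpr.cls (ZFpr.comp (zero_add 1) (ZFpr.ofHom ((linePair W).restrictHom U)) r) =
        ZFpr.cls (ZFpr.sigma ((linePair W).restrict U)) := by
  have hA := isLinePair_linePair W
  have hV := isLinePair_restrict W F U hU
  set β := hA.fst.proj with hβ
  set t := hA.fst.coord with ht
  set ρ := β.left.appTop.hom with hρ
  obtain ⟨b, hb⟩ := hF0.exists_left_inv
  have hFm : (F.map ρ).Monic := hF.map ρ
  have hb' : ρ b * (F.map ρ).eval 0 = 1 := map_mul_eval_zero ρ hb
  set h := excisionPoly (F.map ρ) (ρ b) t with hh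
  have hm : h.Monic := monic_excisionPoly hFm
  have h1 : F.map ρ ∣ h - 1 := dvd_excisionPoly_sub_one
  have h2 : X ∣ h + C t := X_dvd_excisionPoly_add hb'
  -- The constant homotopy at `h`: support and framing given by `h`, target coordinate `X`. Its
  -- class is both inverses.
  let D : LineFr ρ F := LineFr.homotopy ρ F h h 0 (by simpa using hm) h1 h1
  have hDψ : D.ψ = h := by simp [D, LineFr.homotopy]
  have adm : ∃ a b, a * D.ψ + b * X = C t := by
    obtain ⟨a, ha⟩ := h2
    exact ⟨-1, a, by rw [hDψ]; linear_combination -ha⟩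
  have aD : D.Admissible (X * F) := D.admissible hA.isUnit_coord adm
  -- Composing with the inclusion into `𝔸¹_W` only forgets that the target avoids `F = 0`, that is,
  -- replaces `F` by `1`.
  let D₁ : LineFr ρ 1 := D.ofDvd (one_dvd F)
  have aD₁ : D₁.Admissible (X * 1) := D₁.admissible hA.isUnit_coord adm
  refine ⟨D.toPr hV aD, ?_, ?_⟩
  · have h3 : ZFpr.comp (add_zero 1) (D.toPr hV aD) (ZFpr.ofHom ((linePair W).restrictHom U)) =
        D₁.toPr hA aD₁ :=
      LineFr.toPr_comp_ofHom D₁ hA aD₁ D hV aD ((linePair W).restrictHom U) (Category.comp_id _)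
        rfl rfl rfl
    rw [h3]
    refine hA.cls_toPr_eq_sigma hE monic_one (by simp) D₁ aD₁ (hDψ.symm ▸ hm) rfl rfl ?_
      (hDψ.symm ▸ h2) fun hn => ?_
    · rw [Polynomial.map_one]
      exact one_dvd _
    · change _ ≤ D.ψ.natDegree
      rw [hDψ, natDegree_excisionPoly hFm, natDegree_one]
      omega
  · set θ := ((linePair W).restrictHom U).hom.left.appTop.hom with hθ
    have hβ' : ((linePair W).restrictHom U).hom ≫ β = hV.fst.proj := rfl
    -- Composing with the inclusion on the source side restricts the coefficients to `V`; the
    -- construction of `h` commutes with this, so it yields the polynomial for the coordinate of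
    -- `V`, where `F(t)` is a unit.
    let D₂ : LineFr hV.fst.proj.left.appTop.hom F := D.map θ rfl
    have hD₂ : D₂.ψ = excisionPoly (F.map hV.fst.proj.left.appTop.hom)
        (hV.fst.proj.left.appTop.hom b) hV.fst.coord := by
      change D.ψ.map θ = _
      rw [hDψ, hh, map_excisionPoly, Polynomial.map_map]
      rfl
    have hFm₂ := hF.map hV.fst.proj.left.appTop.hom
    have hb₂ : hV.fst.proj.left.appTop.hom b * (F.map hV.fst.proj.left.appTop.hom).eval 0 = 1 :=
      map_mul_eval_zero _ hb
    have hy₂ : D₂.y = X := map_X _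
    have h4 : X ∣ D₂.ψ + C hV.fst.coord := hD₂ ▸ X_dvd_excisionPoly_add hb₂
    have aD₂ : D₂.Admissible (X * F) := by
      refine D₂.admissible hV.isUnit_coord ?_
      obtain ⟨a, ha⟩ := h4
      exact ⟨-1, a, by rw [hy₂]; linear_combination -ha⟩
    have h3 : ZFpr.comp (zero_add 1) (ZFpr.ofHom ((linePair W).restrictHom U)) (D.toPr hV aD) =
        D₂.toPr hV aD₂ :=
      LineFr.ofHom_comp_toPr D D₂ hV aD aD₂ _ hβ' rfl rfl rfl
    rw [h3]
    refine hV.cls_toPr_eq_sigma hE' hF hF0 D₂ aD₂ (hD₂ ▸ monic_excisionPoly hFm₂)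
      (Polynomial.map_one _) hy₂ (hD₂ ▸ dvd_excisionPoly_sub_one) h4 fun hn => ?_
    rw [hD₂, natDegree_excisionPoly hFm₂, hF.natDegree_map]

end FramedCorr

end

theorem mainTheorem9 {k : Type u} [Field k] (X : Over (Spec (CommRingCat.of k)))
    (hsm : Smooth X.hom) (hsep : IsSeparated X.hom) (hqc : QuasiCompact X.hom) (x : X.left)
    (f : Polynomial (X.left.presheaf.stalk x)) (hf : f.Monic) (hf0 : IsUnit (f.eval 0)) :
    let A := linePair (localScheme X x)
    let V := lineOpen X x f
    let i := ZFpr.ofHom (A.restrictHom V)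
    ∃ r l : ZFpr 1 A (A.restrict V),
      ZFpr.cls (ZFpr.comp (add_zero 1) r i) = ZFpr.cls (ZFpr.sigma A) ∧
      ZFpr.cls (ZFpr.comp (zero_add 1) i l) = ZFpr.cls (ZFpr.sigma (A.restrict V)) := by
  have hU : lineOpen X x f = (Aff 1 (localScheme X x).left).basicOpen
      (polyEval _ (f.map (Scheme.ΓSpecIso (X.left.presheaf.stalk x)).inv.hom)) :=
    congrArg (Scheme.basicOpen _) (polyFun_eq_polyEval f)
  have hF0 : IsUnit ((f.map (Scheme.ΓSpecIso (X.left.presheaf.stalk x)).inv.hom).eval 0) := by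
    rw [Polynomial.eval_map, ← map_zero (Scheme.ΓSpecIso (X.left.presheaf.stalk x)).inv.hom,
      Polynomial.eval₂_at_apply]
    exact hf0.map _
  obtain ⟨r, h1, h2⟩ := exists_excision (localScheme X x) _ (hf.map _) hF0 _ hU
    ((isLinePair_linePair _).snd.isEssentiallySmooth hsm hsep hqc)
    ((isLinePair_restrict _ _ _ hU).snd.isEssentiallySmooth hsm hsep hqc)
  -- A single correspondence is inverse to the inclusion on both sides.
  exact ⟨r, r, h1, h2⟩
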